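/- Let $T>0$ and $\alpha,\gamma\in(0,1]$ with $\alpha+\gamma>1$, and consider real-valued processes on $[0,T]$ on a probability space $(\Omega,\mathcal F,\mathbb P)$. Write $Y\in C^\gamma$ if almost every path of $Y$ is Hölder continuous of order $\gamma$ on $[0,T]$ (with a random constant). Write $X\in BV_iC^\alpha$ if almost surely $X_t=g(H_t)$ for all $t\in[0,T]$, where $g:\mathbb R\to\mathbb R$ has locally bounded variation and $H\in C^\alpha$ is a process such that, for almost every $t\in[0,T]$, $H_t$ has a density $p_t$ with $\sup_y p_t(y)\le G(t)$, for some $G\in L^1([0,T])$. For $0<\beta<1$ and $f,h:[0,T]\to\mathbb R$ measurable with $$\|f\|_{2,\beta}=\int_0^T\frac{|f(s)|}{s^\beta}\,ds+\int_0^T\!\int_0^s\frac{|f(u)-f(s)|}{(s-u)^{1+\beta}}\,du\,ds<\infty,$$ $$\|h\|_{1,1-\beta}=\sup_{0\le s<t\le T}\Big(\frac{|h(t)-h(s)|}{(t-s)^{1-\beta}}+\int_s^t\frac{|h(u)-h(s)|}{(u-s)^{2-\beta}}\,du\Big)<\infty,$$ and $h$ continuous, the generalized Lebesgue–Stieltjes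 integral is the Lebesgue integral $$\int_0^T f\,dh=-\int_0^T\frac{1}{\Gamma(1-\beta)}\Big(\frac{f(s)}{s^\beta}+\beta\int_0^s\frac{f(s)-f(u)}{(s-u)^{1+\beta}}\,du\Big)\cdot\frac{1}{\Gamma(\beta)}\Big(\frac{h(s)-h(T)}{(T-s)^{1-\beta}}+(1-\beta)\int_s^T\frac{h(s)-h(u)}{(u-s)^{2-\beta}}\,du\Big)ds .$$ Theorem. Let $X\in BV_iC^\alpha$ and $Y\in C^\gamma$. Then almost surely the following holds. 1. The integral $\int_0^T Y_u\,dX_u$ exists as a limit of Riemann–Stieltjes sums: the sums $\sum_{i=1}^{k}Y_{\xi_i}(X_{t_i}-X_{t_{i-1}})$ over partitions $0=t_0<\dots<t_k=T$ with arbitrary tags $\xi_i\in[t_{i-1},t_i]$ converge to it as $\max_i|t_i-t_{i-1}|\to0$. 2. The integral $\int_0^T X_u\,dY_u$ exists in the generalized Lebesgue–Stieltjes sense for every $\beta\in(1-\gamma,\alpha)$, with a value independent of $\beta$ that is also the limit of the Riemann–Stieltjes sums $\sum_{i=1}^{k}X_{\xi_i}(Y_{t_i}-Y_{t_{i-1}})$,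 and $$\int_0^T X_u\,dY_u=X_TY_T-X_0Y_0-\int_0^T Y_u\,dX_u .$$ -/

import Mathlib

open MeasureTheory ProbabilityTheory Set
open scoped NNReal ENNReal

noncomputable section

/-! ### Processes -/

/-- A real stochastic process on `[0,T]` whose paths are almost surely Hölder continuous of order
`r` on `[0,T]`, with a Hölder constant that may depend on `ω`. -/
def IsHolderProcess {Ω : Type*} [MeasurableSpace Ω] (P : Measure Ω) (T : ℝ) (r : ℝ≥0)
    (X : ℝ → Ω → ℝ) : Prop :=
  (∀ t ∈ Icc 0 T, Measurable (X t)) ∧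
    ∀ᵐ ω ∂P, ∃ C : ℝ≥0, HolderOnWith C r (fun t => X t ω) (Icc 0 T)

/-- For almost every `t ∈ [0,T]` the random variable `X t` has a density `p_t`, and
`sup_y p_t(y) ≤ G t` for some `G ∈ L¹([0,T])`. A density is determined up to null sets only, so the
bound is asked for almost every `y`. -/
def HasDominatedDensities {Ω : Type*} [MeasurableSpace Ω] (P : Measure Ω) (T : ℝ)
    (X : ℝ → Ω → ℝ) : Prop :=
  ∃ G : ℝ → ℝ, IntegrableOn G (Icc 0 T) ∧
    ∀ᵐ t ∂(volume.restrict (Icc 0 T)),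
      HasPDF (X t) P volume ∧ ∀ᵐ y ∂(volume : Measure ℝ), pdf (X t) P volume y ≤ ENNReal.ofReal (G t)

/-- The class `BV_i C^r`: up to indistinguishability, `Z_t = g(X_t)` on `[0,T]` with `g : ℝ → ℝ` of
locally bounded variation and `X` an `r`-Hölder process with dominated densities. -/
def MemBViC {Ω : Type*} [MeasurableSpace Ω] (P : Measure Ω) (T : ℝ) (r : ℝ≥0)
    (Z : ℝ → Ω → ℝ) : Prop :=
  ∃ (g : ℝ → ℝ) (X : ℝ → Ω → ℝ),
    LocallyBoundedVariationOn g univ ∧ IsHolderProcess P T r X ∧ HasDominatedDensities P T X ∧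
      ∀ᵐ ω ∂P, ∀ t ∈ Icc 0 T, Z t ω = g (X t ω)

/-! ### Riemann–Stieltjes integrals -/

/-- `0 = t 0 < t 1 < ⋯ < t k = T` with tags `ξ i ∈ [t i, t (i+1)]` for `i < k`. -/
def IsTaggedPartition (T : ℝ) (k : ℕ) (t ξ : ℕ → ℝ) : Prop :=
  t 0 = 0 ∧ t k = T ∧ (∀ i < k, t i < t (i + 1)) ∧ ∀ i < k, ξ i ∈ Icc (t i) (t (i + 1))

/-- The Riemann–Stieltjes sum `∑ f(ξ_i) (g(t_{i+1}) - g(t_i))`. -/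
def rsSum (f g : ℝ → ℝ) (k : ℕ) (t ξ : ℕ → ℝ) : ℝ :=
  ∑ i ∈ Finset.range k, f (ξ i) * (g (t (i + 1)) - g (t i))

/-- `∫_0^T f dg` exists as the limit of all Riemann–Stieltjes sums, with arbitrary tags, as the mesh
of the partition tends to zero, and equals `I`. -/
def HasRSIntegral (T : ℝ) (f g : ℝ → ℝ) (I : ℝ) : Prop :=
  ∀ ε > 0, ∃ δ > 0, ∀ (k : ℕ) (t ξ : ℕ → ℝ), IsTaggedPartition T k t ξ →
    (∀ i < k, t (i + 1) - t i < δ) → |rsSum f g k t ξ - I| < ε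

/-! ### Generalized Lebesgue–Stieltjes integrals -/

/-- The norm `‖f‖_{1,β}` of the fractional Besov space `W_1^β([0,T])`, with values in `[0,∞]`. -/
def besovNorm₁ (T β : ℝ) (f : ℝ → ℝ) : ℝ≥0∞ :=
  ⨆ (s : ℝ) (t : ℝ) (_ : 0 ≤ s ∧ s < t ∧ t ≤ T),
    (ENNReal.ofReal (|f t - f s| / (t - s) ^ β) +
      ∫⁻ u in Ioc s t, ENNReal.ofReal (|f u - f s| / (u - s) ^ (1 + β)))

/-- The norm `‖f‖_{2,β}` of the fractional Besov space `W_2^β([0,T])`, with values in `[0,∞]`. -/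
def besovNorm₂ (T β : ℝ) (f : ℝ → ℝ) : ℝ≥0∞ :=
  (∫⁻ s in Ioc 0 T, ENNReal.ofReal (|f s| / s ^ β)) +
    ∫⁻ s in Ioc 0 T, ∫⁻ u in Ioo 0 s, ENNReal.ofReal (|f u - f s| / (s - u) ^ (1 + β))

/-- `f ∈ W_1^β([0,T])`. -/
def MemBesov₁ (T β : ℝ) (f : ℝ → ℝ) : Prop :=
  Measurable (fun t : Icc 0 T => f t) ∧ besovNorm₁ T β f < ∞

/-- `f ∈ W_2^β([0,T])`. -/
def MemBesov₂ (T β : ℝ) (f : ℝ → ℝ) : Prop :=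
  Measurable (fun t : Icc 0 T => f t) ∧ besovNorm₂ T β f < ∞

/-- The left-sided fractional derivative `D^β_{0+} f` in Weyl form. -/
def weylLeft (β : ℝ) (f : ℝ → ℝ) (s : ℝ) : ℝ :=
  (Real.Gamma (1 - β))⁻¹ *
    (f s / s ^ β + β * ∫ u in (0 : ℝ)..s, (f s - f u) / (s - u) ^ (β + 1))

/-- The right-sided fractional derivative `D^β_{t-} f` in Weyl form, without the unimodular constant
`(-1)^β`. -/
def weylRight (β t : ℝ) (f : ℝ → ℝ) (s : ℝ) : ℝ :=
  (Real.Gamma (1 - β))⁻¹ *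
    (f s / (t - s) ^ β + β * ∫ u in s..t, (f s - f u) / (u - s) ^ (β + 1))

/-- The integrand `(-1)^β D^β_{0+} f(s) · D^{1-β}_{T-} g_{T-}(s)` of the generalized
Lebesgue–Stieltjes integral, where `g_{T-}(s) = g(s) - g(T)` for an integrator that is
left-continuous at `T`. The constants `(-1)^β` and `(-1)^{1-β}` multiply to the sign `-1`. -/
def glsIntegrand (T β : ℝ) (f g : ℝ → ℝ) (s : ℝ) : ℝ :=
  -(weylLeft β f s * weylRight (1 - β) T (fun u => g u - g T) s)

/-- For a continuous integrator `g`: the generalized Lebesgue–Stieltjes integral `∫_0^T f dg` exists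
with parameter `β`, that is `f ∈ W_2^β`, `g ∈ W_1^{1-β}` and the defining integrand is Lebesgue
integrable, and its value is `I`. -/
def HasGLSIntegral (T β : ℝ) (f g : ℝ → ℝ) (I : ℝ) : Prop :=
  MemBesov₂ T β f ∧ MemBesov₁ T (1 - β) g ∧
    IntervalIntegrable (glsIntegrand T β f g) volume 0 T ∧
      ∫ s in (0 : ℝ)..T, glsIntegrand T β f g s = I

end

/-! ### Power singularities -/

/-! A probabilistic estimate is separated from a deterministic theory of paths. Write X = g(H), with
the increments of g dominated by those of a monotone V (`exists_monotone_abs_sub_le`). On a path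
where H is α-Hölder with constant N, the oscillation of X within distance r of t is at most w(t,r) =
V(H_t + N r^α) - V(H_t - N r^α). Since V may jump, w(t,r) need not be small with r at a given t.
However, V(z+c) - V(z-c) integrated over |z| ≤ N is of order c, so a density bounded by G(t) gives
the localized w an expectation of order G(t) r^α. By Tonelli, almost surely w is integrable against
r^{-(q+1)} dr dt for every q < α (`ae_lintegral_weightedIncrement_lt_top`,
`isOscillationModulus_comp`). From X the pathwise part uses only this modulus, measurability and
boundedness.

Fix a path x with such a modulus and a γ-Hölder path y. The moment of order β puts D^β x in L¹, and
β > 1-γ makes D^{1-β} y bounded, so the generalized Lebesgue–Stieltjes integrand is integrable. For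
smooth y, constant after T, fractional integration by parts identifies the integral with ∫ x y',
which is free of β (`integral_glsIntegrand_of_hasDerivAt`). Repeated bisection of the cells compares
Riemann–Stieltjes sums with ∫ x y' (`cell_error_le_bisect`, `rsSum_error_le`). The error depends on
y only through its Hölder constant, and it vanishes with the mesh because 1-γ < α. Mollification
preserves the Hölder constant, so both facts pass to the limit
(`exists_hasGLSIntegral_and_rsSum_tendsto`). Summation by parts, which exchanges partition points
and tags, then yields the integral of Y against X (`hasRSIntegral_of_parts`). -/

lemma intervalIntegrable_sub_rpow_left {c : ℝ} (hc : -1 < c) (a b : ℝ) :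
    IntervalIntegrable (fun u : ℝ => (u - a) ^ c) volume a b := by
  have h := (intervalIntegral.intervalIntegrable_rpow' (a := 0) (b := b - a) hc).comp_sub_right a
  simpa using h

lemma intervalIntegrable_sub_rpow_right {c : ℝ} (hc : -1 < c) (a b : ℝ) :
    IntervalIntegrable (fun u : ℝ => (b - u) ^ c) volume a b := by
  have h := (intervalIntegral.intervalIntegrable_rpow' (a := b - a) (b := 0) hc).comp_sub_left b
  simpa using h

lemma integral_sub_rpow_left {c : ℝ} (hc : -1 < c) (a b : ℝ) :
    ∫ u in a..b, (u - a) ^ c = (b - a) ^ (c + 1) / (c + 1) := by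
  rw [intervalIntegral.integral_comp_sub_right (fun u : ℝ => u ^ c) a, integral_rpow (Or.inl hc),
    sub_self, Real.zero_rpow (by linarith), sub_zero]

lemma intervalIntegrable_of_abs_le_rpow {f : ℝ → ℝ} {a b c M : ℝ} (hab : a ≤ b) (hc : -1 < c)
    (hf : AEStronglyMeasurable f (volume.restrict (Ioc a b)))
    (hM : ∀ u ∈ Ioc a b, |f u| ≤ M * (u - a) ^ c) : IntervalIntegrable f volume a b := by
  have h := (intervalIntegrable_sub_rpow_left hc a b).const_mul M
  rw [intervalIntegrable_iff_integrableOn_Ioc_of_le hab] at h ⊢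
  exact h.mono' hf ((ae_restrict_iff' measurableSet_Ioc).2 (Filter.Eventually.of_forall hM))

/-- The Euler beta integral over `[u, w]`. -/
lemma integral_sub_rpow_mul_sub_rpow {β u w : ℝ} (h0 : 0 < β) (h1 : β < 1) (huw : u < w) :
    ∫ s in u..w, (w - s) ^ (β - 1) * (s - u) ^ (-β) = Real.Gamma β * Real.Gamma (1 - β) := by
  have h2 := Complex.betaIntegral_scaled ((1 - β : ℝ) : ℂ) (β : ℂ) (sub_pos.2 huw)
  have h3 := Complex.Gamma_mul_Gamma_eq_betaIntegral (s := ((1 - β : ℝ) : ℂ)) (t := (β : ℂ))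
    (by simpa using h1) (by simpa using h0)
  have e1 : ((1 - β : ℝ) : ℂ) + (β : ℂ) = 1 := by push_cast; ring
  rw [e1, sub_self, Complex.cpow_zero, one_mul] at h2
  rw [e1, Complex.Gamma_one, one_mul, ← h2, Complex.Gamma_ofReal, Complex.Gamma_ofReal] at h3
  have h4 : ∫ x in (0 : ℝ)..(w - u), (x : ℂ) ^ (((1 - β : ℝ) : ℂ) - 1) *
      (((w - u : ℝ) : ℂ) - x) ^ ((β : ℂ) - 1) =
      ((∫ x in (0 : ℝ)..(w - u), (w - u - x) ^ (β - 1) * x ^ (-β) : ℝ) : ℂ) := by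
    rw [← intervalIntegral.integral_ofReal]
    apply intervalIntegral.integral_congr
    intro x hx
    rw [uIcc_of_le (sub_pos.2 huw).le] at hx
    simp only
    rw [Complex.ofReal_mul, Complex.ofReal_cpow hx.1, Complex.ofReal_cpow (by linarith [hx.2])]
    push_cast
    rw [mul_comm]
    congr 2
    ring
  rw [h4] at h3
  have h5 := intervalIntegral.integral_comp_sub_right
    (fun x : ℝ => (w - u - x) ^ (β - 1) * x ^ (-β)) u (a := u) (b := w)
  rw [sub_self] at h5
  have h6 : ∀ s : ℝ, w - u - (s - u) = w - s := fun s => by ring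
  simp only [h6] at h5
  rw [h5, mul_comm]
  exact_mod_cast h3.symm

/-! ### Weyl derivatives of continuously differentiable functions -/

lemma exists_abs_sub_le_of_hasDerivAt {h h' : ℝ → ℝ} (hd : ∀ u, HasDerivAt h (h' u) u)
    (hc : Continuous h') (a b : ℝ) :
    ∃ M : ℝ, 0 ≤ M ∧ (∀ u ∈ Icc a b, |h' u| ≤ M) ∧
      ∀ u ∈ Icc a b, ∀ v ∈ Icc a b, |h v - h u| ≤ M * |v - u| := by
  obtain ⟨M, hM⟩ := isCompact_Icc.exists_bound_of_continuousOn (hc.continuousOn (s := Icc a b))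
  refine ⟨max M 0, le_max_right _ _, fun u hu => (hM u hu).trans (le_max_left _ _), ?_⟩
  intro u hu v hv
  exact (convex_Icc a b).norm_image_sub_le_of_norm_hasDerivWithin_le
    (fun x _ => (hd x).hasDerivWithinAt) (fun x hx => (hM x hx).trans (le_max_left _ _)) hu hv

/-- Integration by parts with primitive (h s - h u)(u - s)^{-δ}. The boundary term at s vanishes
because h is Lipschitz and δ < 1; the one at T cancels the non-integral term of the Weyl derivative.
-/
lemma weylRight_eq_of_hasDerivAt {δ T s : ℝ} (h1 : δ < 1) (hs : s < T)
    {h h' : ℝ → ℝ} (hd : ∀ u, HasDerivAt h (h' u) u) (hc : Continuous h') (hT : h T = 0) :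
    weylRight δ T h s = -((Real.Gamma (1 - δ))⁻¹ * ∫ u in s..T, h' u * (u - s) ^ (-δ)) := by
  obtain ⟨M, hM0, hM, hL⟩ := exists_abs_sub_le_of_hasDerivAt hd hc s T
  have hcont : Continuous h := continuous_iff_continuousAt.2 fun u => (hd u).continuousAt
  have i1 : IntervalIntegrable (fun u => h' u * (u - s) ^ (-δ)) volume s T := by
    apply (intervalIntegrable_sub_rpow_left (by linarith) s T).continuousOn_mul hc.continuousOn
  have i2 : IntervalIntegrable (fun u => (h s - h u) / (u - s) ^ (δ + 1)) volume s T := by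
    apply intervalIntegrable_of_abs_le_rpow hs.le (c := -δ) (M := M) (by linarith)
    · exact Measurable.aestronglyMeasurable (by fun_prop)
    · intro u hu
      have hpos : 0 < u - s := sub_pos.2 hu.1
      rw [abs_div, abs_of_pos (Real.rpow_pos_of_pos hpos _), div_le_iff₀ (by positivity), mul_assoc,
        ← Real.rpow_add hpos, show -δ + (δ + 1) = 1 by ring, Real.rpow_one]
      have := hL u ⟨hu.1.le, hu.2⟩ s ⟨le_rfl, hs.le⟩
      rwa [abs_sub_comm s u, abs_of_pos hpos] at this
  have key : ∫ u in s..T, (-(h' u * (u - s) ^ (-δ)) - δ * ((h s - h u) / (u - s) ^ (δ + 1))) =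
      (h s - h T) * (T - s) ^ (-δ) - (h s - h s) * (s - s) ^ (-δ) := by
    apply intervalIntegral.integral_eq_sub_of_hasDerivAt_of_le hs.le
      (f := fun u => (h s - h u) * (u - s) ^ (-δ))
    · intro u hu
      rcases hu.1.eq_or_lt with rfl | hlt
      -- At the singular endpoint the Lipschitz bound dominates the primitive by M |u - s|^{1-δ}.
      · have hlim : Filter.Tendsto (fun u => M * |u - s| ^ (1 - δ)) (nhdsWithin s (Icc s T))
            (nhds 0) := by
          have : ContinuousAt (fun u => M * |u - s| ^ (1 - δ)) s := by
            apply ContinuousAt.mul continuousAt_const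
            apply ContinuousAt.rpow_const (by fun_prop)
            right; linarith
          have h2 := this.tendsto
          simp only [sub_self, abs_zero] at h2
          rw [Real.zero_rpow (by linarith), mul_zero] at h2
          exact h2.mono_left nhdsWithin_le_nhds
        unfold ContinuousWithinAt
        simp only [sub_self, zero_mul]
        apply squeeze_zero_norm' _ hlim
        filter_upwards [self_mem_nhdsWithin] with v hv
        rcases hv.1.eq_or_lt with rfl | hlt
        · simp only [sub_self, zero_mul, norm_zero, abs_zero]
          positivity
        · have hpos : 0 < v - s := sub_pos.2 hlt
          rw [norm_mul, Real.norm_eq_abs, Real.norm_eq_abs,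
            abs_of_pos (Real.rpow_pos_of_pos hpos _)]
          have h3 := hL v hv s ⟨le_rfl, hs.le⟩
          rw [abs_sub_comm s v] at h3
          calc |h s - h v| * (v - s) ^ (-δ) ≤ (M * |v - s|) * (v - s) ^ (-δ) := by gcongr
            _ = M * |v - s| ^ (1 - δ) := by
              rw [abs_of_pos hpos, mul_assoc, sub_eq_add_neg 1 δ, Real.rpow_add hpos, Real.rpow_one]
      · apply ContinuousAt.continuousWithinAt
        apply ContinuousAt.mul (by fun_prop)
        apply ContinuousAt.rpow_const (by fun_prop)
        left; linarith
    · intro u hu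
      have hpos : 0 < u - s := sub_pos.2 hu.1
      have h2 := ((hd u).const_sub (h s)).mul
        (((hasDerivAt_id u).sub_const s).rpow_const (p := -δ) (Or.inl hpos.ne'))
      refine h2.congr_deriv ?_
      simp only [id]
      rw [show -δ - 1 = -(δ + 1) by ring, Real.rpow_neg hpos.le (δ + 1)]
      ring
    · exact i1.neg.sub (i2.const_mul δ)
  rw [intervalIntegral.integral_sub (by exact i1.neg) (i2.const_mul δ),
    intervalIntegral.integral_neg, intervalIntegral.integral_const_mul, hT] at key
  unfold weylRight
  rw [sub_self, zero_mul, sub_zero, sub_zero, Real.rpow_neg (sub_pos.2 hs).le] at key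
  rw [div_eq_mul_inv, ← key]
  ring

/-! ### Integration over triangles -/

section Triangle

variable {F : ℝ → ℝ → ℝ} {a b : ℝ}

lemma measurableSet_fst_lt_snd : MeasurableSet {p : ℝ × ℝ | p.1 < p.2} :=
  measurableSet_lt measurable_fst measurable_snd

lemma setIntegral_indicator_lt_right {s : ℝ} (hs : s ∈ Ioc a b) :
    ∫ w in Ioc a b, {p : ℝ × ℝ | p.1 < p.2}.indicator (Function.uncurry F) (s, w) =
      ∫ w in s..b, F s w := by
  have : ∀ w, {p : ℝ × ℝ | p.1 < p.2}.indicator (Function.uncurry F) (s, w) =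
      (Ioi s).indicator (F s) w := by
    intro w
    simp [indicator, Function.uncurry]
  simp_rw [this]
  rw [setIntegral_indicator measurableSet_Ioi, intervalIntegral.integral_of_le hs.2, Ioc_inter_Ioi,
    sup_of_le_right hs.1.le]

lemma setIntegral_indicator_lt_left {w : ℝ} (hw : w ∈ Ioc a b) :
    ∫ s in Ioc a b, {p : ℝ × ℝ | p.1 < p.2}.indicator (Function.uncurry F) (s, w) =
      ∫ s in a..w, F s w := by
  have : ∀ s, {p : ℝ × ℝ | p.1 < p.2}.indicator (Function.uncurry F) (s, w) =
      (Iio w).indicator (fun s => F s w) s := by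
    intro s
    simp [indicator, Function.uncurry]
  simp_rw [this]
  rw [setIntegral_indicator measurableSet_Iio, intervalIntegral.integral_of_le hw.1.le,
    integral_Ioc_eq_integral_Ioo]
  congr 2
  ext s
  simp only [mem_inter_iff, mem_Ioc, mem_Iio, mem_Ioo]
  exact ⟨fun h => ⟨h.1.1, h.2⟩, fun h => ⟨⟨h.1, h.2.le.trans hw.2⟩, h.2⟩⟩

/-- Fubini for the indicator of the triangle in the square. The planar integral is shared with
`integral_triangle_right`, so the two together exchange the order of integration. -/
lemma integral_triangle_left (hab : a ≤ b)
    (hF : IntegrableOn (Function.uncurry F) {p : ℝ × ℝ | p.1 < p.2}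
      ((volume.restrict (Ioc a b)).prod (volume.restrict (Ioc a b)))) :
    ∫ p in {p : ℝ × ℝ | p.1 < p.2}, Function.uncurry F p
      ∂((volume.restrict (Ioc a b)).prod (volume.restrict (Ioc a b))) =
      ∫ s in a..b, ∫ w in s..b, F s w := by
  rw [← integral_indicator measurableSet_fst_lt_snd,
    integral_prod _ ((integrable_indicator_iff measurableSet_fst_lt_snd).2 hF),
    intervalIntegral.integral_of_le hab]
  exact setIntegral_congr_fun measurableSet_Ioc fun s hs => setIntegral_indicator_lt_right hs

lemma integral_triangle_right (hab : a ≤ b)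
    (hF : IntegrableOn (Function.uncurry F) {p : ℝ × ℝ | p.1 < p.2}
      ((volume.restrict (Ioc a b)).prod (volume.restrict (Ioc a b)))) :
    ∫ p in {p : ℝ × ℝ | p.1 < p.2}, Function.uncurry F p
      ∂((volume.restrict (Ioc a b)).prod (volume.restrict (Ioc a b))) =
      ∫ w in a..b, ∫ s in a..w, F s w := by
  rw [← integral_indicator measurableSet_fst_lt_snd,
    integral_prod_symm _ ((integrable_indicator_iff measurableSet_fst_lt_snd).2 hF),
    intervalIntegral.integral_of_le hab]
  exact setIntegral_congr_fun measurableSet_Ioc fun s hs => setIntegral_indicator_lt_left hs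

lemma intervalIntegrable_triangle_left (hab : a ≤ b)
    (hF : IntegrableOn (Function.uncurry F) {p : ℝ × ℝ | p.1 < p.2}
      ((volume.restrict (Ioc a b)).prod (volume.restrict (Ioc a b)))) :
    IntervalIntegrable (fun s => ∫ w in s..b, F s w) volume a b := by
  rw [intervalIntegrable_iff_integrableOn_Ioc_of_le hab]
  refine ((integrable_indicator_iff measurableSet_fst_lt_snd).2 hF).integral_prod_left.congr ?_
  filter_upwards [ae_restrict_mem measurableSet_Ioc] with s hs
  exact setIntegral_indicator_lt_right hs

lemma intervalIntegrable_triangle_right (hab : a ≤ b)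
    (hF : IntegrableOn (Function.uncurry F) {p : ℝ × ℝ | p.1 < p.2}
      ((volume.restrict (Ioc a b)).prod (volume.restrict (Ioc a b)))) :
    IntervalIntegrable (fun w => ∫ s in a..w, F s w) volume a b := by
  rw [intervalIntegrable_iff_integrableOn_Ioc_of_le hab]
  refine ((integrable_indicator_iff measurableSet_fst_lt_snd).2 hF).integral_prod_right.congr ?_
  filter_upwards [ae_restrict_mem measurableSet_Ioc] with s hs
  exact setIntegral_indicator_lt_left hs

end Triangle

lemma aestronglyMeasurable_integral_right {F : ℝ → ℝ → ℝ} (hF : Measurable (Function.uncurry F))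
    (a b : ℝ) :
    AEStronglyMeasurable (fun s => ∫ w in s..b, F s w) (volume.restrict (Ioc a b)) := by
  have h : StronglyMeasurable fun s => ∫ w in Ioc a b,
      {p : ℝ × ℝ | p.1 < p.2}.indicator (Function.uncurry F) (s, w) :=
    (hF.indicator measurableSet_fst_lt_snd).stronglyMeasurable.integral_prod_right'
  refine h.aestronglyMeasurable.congr ?_
  filter_upwards [ae_restrict_mem measurableSet_Ioc] with s hs
  exact setIntegral_indicator_lt_right hs

/-! ### The right-sided potential -/

/-- The right-sided fractional integral, up to the factor `Γ(β)`, of a function that vanishes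
on `[T, ∞)`. -/
noncomputable def rightPotential (β T : ℝ) (φ : ℝ → ℝ) (s : ℝ) : ℝ :=
  ∫ r in (0 : ℝ)..T, φ (s + r) * r ^ (β - 1)

lemma intervalIntegrable_rpow_sub_one {β : ℝ} (h0 : 0 < β) (T : ℝ) :
    IntervalIntegrable (fun r : ℝ => r ^ (β - 1)) volume 0 T :=
  intervalIntegral.intervalIntegrable_rpow' (by linarith)

lemma exists_abs_le_add {φ : ℝ → ℝ} (hφ : Continuous φ) (T s₀ : ℝ) :
    ∃ M : ℝ, ∀ s ∈ Icc (s₀ - 1) (s₀ + 1), ∀ r ∈ Icc 0 T, |φ (s + r)| ≤ M := by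
  obtain ⟨M, hM⟩ := isCompact_Icc.exists_bound_of_continuousOn
    (hφ.continuousOn (s := Icc (s₀ - 1) (s₀ + 1 + T)))
  exact ⟨M, fun s hs r hr => hM _ ⟨by linarith [hs.1, hr.1], by linarith [hs.2, hr.2]⟩⟩

lemma continuous_rightPotential {β T : ℝ} (h0 : 0 < β) (hT : 0 ≤ T) {φ : ℝ → ℝ}
    (hφ : Continuous φ) : Continuous (rightPotential β T φ) := by
  rw [continuous_iff_continuousAt]
  intro s₀
  obtain ⟨M, hM⟩ := exists_abs_le_add hφ T s₀
  apply intervalIntegral.continuousAt_of_dominated_interval (bound := fun r => M * r ^ (β - 1))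
  · refine Filter.Eventually.of_forall fun s => Measurable.aestronglyMeasurable ?_
    have := hφ.measurable
    fun_prop
  · filter_upwards [Icc_mem_nhds (show s₀ - 1 < s₀ by linarith) (show s₀ < s₀ + 1 by linarith)]
      with s hs
    refine Filter.Eventually.of_forall fun r hr => ?_
    rw [uIoc_of_le hT] at hr
    rw [norm_mul, Real.norm_eq_abs, Real.norm_eq_abs,
      abs_of_nonneg (Real.rpow_nonneg hr.1.le _)]
    have := hM s hs r ⟨hr.1.le, hr.2⟩
    have := Real.rpow_nonneg hr.1.le (β - 1)
    gcongr
  · exact (intervalIntegrable_rpow_sub_one h0 T).const_mul M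
  · exact Filter.Eventually.of_forall fun r _ => by fun_prop

/-- The integration variable is the offset from s, so the singular weight does not depend on s and
the derivative falls on φ alone. -/
lemma hasDerivAt_rightPotential {β T : ℝ} (h0 : 0 < β) (hT : 0 ≤ T) {φ φ' : ℝ → ℝ}
    (hd : ∀ u, HasDerivAt φ (φ' u) u) (hc : Continuous φ') (s₀ : ℝ) :
    HasDerivAt (rightPotential β T φ) (rightPotential β T φ' s₀) s₀ := by
  have hφ : Continuous φ := continuous_iff_continuousAt.2 fun u => (hd u).continuousAt
  obtain ⟨M, hM⟩ := exists_abs_le_add hc T s₀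
  have hm := hφ.measurable
  have hm' := hc.measurable
  refine (intervalIntegral.hasDerivAt_integral_of_dominated_loc_of_deriv_le
    (F := fun s r => φ (s + r) * r ^ (β - 1)) (F' := fun s r => φ' (s + r) * r ^ (β - 1))
    (bound := fun r => M * r ^ (β - 1))
    (Icc_mem_nhds (show s₀ - 1 < s₀ by linarith) (show s₀ < s₀ + 1 by linarith))
    ?_ ?_ ?_ ?_ ?_ ?_).2
  · exact Filter.Eventually.of_forall fun s => Measurable.aestronglyMeasurable (by fun_prop)
  · exact (intervalIntegrable_rpow_sub_one h0 T).continuousOn_mul (by fun_prop)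
  · exact Measurable.aestronglyMeasurable (by fun_prop)
  · refine Filter.Eventually.of_forall fun r hr s hs => ?_
    rw [uIoc_of_le hT] at hr
    rw [norm_mul, Real.norm_eq_abs, Real.norm_eq_abs,
      abs_of_nonneg (Real.rpow_nonneg hr.1.le _)]
    have := hM s hs r ⟨hr.1.le, hr.2⟩
    have := Real.rpow_nonneg hr.1.le (β - 1)
    gcongr
  · exact (intervalIntegrable_rpow_sub_one h0 T).const_mul M
  · refine Filter.Eventually.of_forall fun r hr s hs => ?_
    exact ((hd (s + r)).comp_add_const s r).mul_const _

/-- Substituting v = s + r gives an integral up to s + T, whose part beyond T vanishes with φ. -/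
lemma rightPotential_eq {β T s : ℝ} (h0 : 0 < β) (hs : s ∈ Icc 0 T) {φ : ℝ → ℝ}
    (hφ : Continuous φ) (hz : ∀ u, T ≤ u → φ u = 0) :
    rightPotential β T φ s = ∫ v in s..T, φ v * (v - s) ^ (β - 1) := by
  have h1 := intervalIntegral.integral_comp_add_left (a := 0) (b := T)
    (fun v => φ v * (v - s) ^ (β - 1)) s
  simp only [add_sub_cancel_left, add_zero] at h1
  have hi : ∀ c, IntervalIntegrable (fun v => φ v * (v - s) ^ (β - 1)) volume s c := fun c =>
    (intervalIntegrable_sub_rpow_left (by linarith) s c).continuousOn_mul hφ.continuousOn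
  have h2 : ∫ v in T..(s + T), φ v * (v - s) ^ (β - 1) = 0 := by
    rw [intervalIntegral.integral_congr (g := fun _ => 0)]
    · simp
    · intro v hv
      rw [uIcc_of_le (by linarith [hs.1])] at hv
      simp [hz v hv.1]
  unfold rightPotential
  rw [h1, ← intervalIntegral.integral_add_adjacent_intervals (hi T) ((hi T).symm.trans (hi _)), h2,
    add_zero]

/-- The Weyl derivative inverts the fractional integral. By `weylRight_eq_of_hasDerivAt` and Fubini,
the inner integral is an Euler beta integral equal to Γ(β)Γ(1-β), independent of the endpoints; what
remains is the integral of φ' from u to T, that is -φ(u). -/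
lemma weylRight_rightPotential {β T u : ℝ} (h0 : 0 < β) (h1 : β < 1) (hu : u ∈ Ico 0 T)
    {φ φ' : ℝ → ℝ} (hd : ∀ u, HasDerivAt φ (φ' u) u) (hc : Continuous φ')
    (hz : ∀ u, T ≤ u → φ u = 0) (hz' : ∀ u, T ≤ u → φ' u = 0) :
    weylRight β T (rightPotential β T φ) u = Real.Gamma β * φ u := by
  have hT : 0 ≤ T := hu.1.trans hu.2.le
  have hφ : Continuous φ := continuous_iff_continuousAt.2 fun u => (hd u).continuousAt
  have hR : rightPotential β T φ T = 0 := by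
    rw [rightPotential_eq h0 ⟨hT, le_rfl⟩ hφ hz, intervalIntegral.integral_same]
  rw [weylRight_eq_of_hasDerivAt h1 hu.2 (fun s => hasDerivAt_rightPotential h0 hT hd hc s)
    (continuous_rightPotential h0 hT hc) hR]
  have hΓ : Real.Gamma β * Real.Gamma (1 - β) ≠ 0 :=
    (mul_pos (Real.Gamma_pos_of_pos h0) (Real.Gamma_pos_of_pos (by linarith))).ne'
  set F : ℝ → ℝ → ℝ := fun s w => φ' w * ((w - s) ^ (β - 1) * (s - u) ^ (-β)) with hF
  have e1 : ∫ s in u..T, rightPotential β T φ' s * (s - u) ^ (-β) =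
      ∫ s in u..T, ∫ w in s..T, F s w := by
    apply intervalIntegral.integral_congr
    intro s hs
    rw [uIcc_of_le hu.2.le] at hs
    simp only [hF]
    rw [rightPotential_eq h0 ⟨hu.1.trans hs.1, hs.2⟩ hc hz', ← intervalIntegral.integral_mul_const]
    simp_rw [mul_assoc]
  have e2 : ∀ w ∈ Ioc u T, ∫ s in u..w, F s w = φ' w * (Real.Gamma β * Real.Gamma (1 - β)) := by
    intro w hw
    simp only [hF]
    rw [intervalIntegral.integral_const_mul, integral_sub_rpow_mul_sub_rpow h0 h1 hw.1]
  have hmeas : Measurable (Function.uncurry F) := by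
    have := hc.measurable
    simp only [hF]
    unfold Function.uncurry
    fun_prop
  have hint : IntegrableOn (Function.uncurry F) {p : ℝ × ℝ | p.1 < p.2}
      ((volume.restrict (Ioc u T)).prod (volume.restrict (Ioc u T))) := by
    rw [← integrable_indicator_iff measurableSet_fst_lt_snd,
      integrable_prod_iff' (hmeas.indicator measurableSet_fst_lt_snd).aestronglyMeasurable]
    constructor
    · filter_upwards [ae_restrict_mem measurableSet_Ioc] with w hw
      have hbeta : IntervalIntegrable (fun s => (w - s) ^ (β - 1) * (s - u) ^ (-β)) volume u w := by
        -- Integrability comes for free from the beta formula: a non-integrable function would have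
        -- integral 0, but the value is nonzero.
        by_contra hcon
        apply hΓ
        rw [← integral_sub_rpow_mul_sub_rpow h0 h1 hw.1, intervalIntegral.integral_undef hcon]
      rw [intervalIntegrable_iff_integrableOn_Ioo_of_le hw.1.le,
        ← integrable_indicator_iff measurableSet_Ioo] at hbeta
      refine ((hbeta.const_mul (φ' w)).restrict (s := Ioc u T)).congr ?_
      filter_upwards [ae_restrict_mem measurableSet_Ioc] with s hs
      by_cases h : s < w
      · rw [indicator_of_mem (show (s, w) ∈ {p : ℝ × ℝ | p.1 < p.2} from h),
          indicator_of_mem (show s ∈ Ioo u w from ⟨hs.1, h⟩)]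
        rfl
      · rw [indicator_of_notMem (show (s, w) ∉ {p : ℝ × ℝ | p.1 < p.2} from h),
          indicator_of_notMem (show s ∉ Ioo u w from fun h' => h h'.2), mul_zero]
    · have hi : Integrable (fun w => |φ' w| * (Real.Gamma β * Real.Gamma (1 - β)))
          (volume.restrict (Ioc u T)) :=
        ((Continuous.intervalIntegrable (by fun_prop) u T).1)
      refine hi.congr ?_
      filter_upwards [ae_restrict_mem measurableSet_Ioc] with w hw
      have h3 := setIntegral_indicator_lt_left (F := fun s w => |F s w|) hw
      have h4 : ∀ s, ‖{p : ℝ × ℝ | p.1 < p.2}.indicator (Function.uncurry F) (s, w)‖ =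
          {p : ℝ × ℝ | p.1 < p.2}.indicator (Function.uncurry fun s w => |F s w|) (s, w) := by
        intro s
        rw [norm_indicator_eq_indicator_norm]
        rfl
      simp_rw [h4]
      rw [h3, ← integral_sub_rpow_mul_sub_rpow h0 h1 hw.1, ← intervalIntegral.integral_const_mul]
      apply intervalIntegral.integral_congr
      intro s hs
      rw [uIcc_of_le hw.1.le] at hs
      simp only [hF]
      rw [abs_mul, abs_of_nonneg (mul_nonneg (Real.rpow_nonneg (by linarith [hs.2]) _)
        (Real.rpow_nonneg (by linarith [hs.1]) _))]
  have e3 : ∫ w in u..T, ∫ s in u..w, F s w =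
      (Real.Gamma β * Real.Gamma (1 - β)) * (-φ u) := by
    rw [intervalIntegral.integral_congr_ae
      (g := fun w => φ' w * (Real.Gamma β * Real.Gamma (1 - β)))]
    · rw [intervalIntegral.integral_mul_const, intervalIntegral.integral_eq_sub_of_hasDerivAt
        (fun x _ => hd x) (hc.intervalIntegrable _ _), hz T le_rfl]
      ring
    · refine Filter.Eventually.of_forall fun w hw => ?_
      rw [uIoc_of_le hu.2.le] at hw
      exact e2 w hw
  rw [e1, ← integral_triangle_left hu.2.le hint, integral_triangle_right hu.2.le hint, e3]
  have : Real.Gamma (1 - β) ≠ 0 := right_ne_zero_of_mul hΓ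
  field_simp

/-! ### Duality of the Weyl derivatives -/

lemma integral_shifted_kernel {β ε a b : ℝ} (h0 : 0 < β) (hε : 0 < ε) (hab : a ≤ b) :
    ∫ r in a..b, (r - a + ε) ^ (-(β + 1)) = (ε ^ (-β) - (b - a + ε) ^ (-β)) / β := by
  have h1 := intervalIntegral.integral_comp_sub_right (fun r : ℝ => r ^ (-(β + 1))) (a - ε)
    (a := a) (b := b)
  have h2 : ∀ r : ℝ, r - (a - ε) = r - a + ε := fun r => by ring
  simp only [h2] at h1
  rw [h1, integral_rpow, sub_self, zero_add, show -(β + 1) + 1 = -β by ring]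
  · field_simp
    ring
  · right
    refine ⟨by linarith, fun h => ?_⟩
    rw [uIcc_of_le (by linarith)] at h
    linarith [h.1]

lemma integral_shifted_kernel' {β ε a b : ℝ} (h0 : 0 < β) (hε : 0 < ε) (hab : a ≤ b) :
    ∫ r in a..b, (b - r + ε) ^ (-(β + 1)) = (ε ^ (-β) - (b - a + ε) ^ (-β)) / β := by
  have h1 := intervalIntegral.integral_comp_sub_left (fun r : ℝ => (r - a + ε) ^ (-(β + 1))) (a + b)
    (a := a) (b := b)
  have h2 : ∀ r : ℝ, a + b - r - a + ε = b - r + ε := fun r => by ring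
  simp only [h2, add_sub_cancel_left, add_sub_cancel_right] at h1
  rw [h1, integral_shifted_kernel h0 hε hab]

/-- Formally the terms f(s) and f(u) are integrated separately, but each diverges on the diagonal.
With the kernel shifted by ε both are explicit, their ε^{-β} parts cancel, and ε → 0 is justified by
domination through `hi` and the bound on f. -/
lemma integral_increment_kernel {β T B : ℝ} (h0 : 0 < β) (h1 : β < 1) (hT : 0 ≤ T) {f : ℝ → ℝ}
    (hf : Measurable f) (hB : ∀ s ∈ Icc 0 T, |f s| ≤ B)
    (hi : IntegrableOn (fun p : ℝ × ℝ => (f p.2 - f p.1) / (p.2 - p.1) ^ (β + 1))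
      {p | p.1 < p.2} ((volume.restrict (Ioc 0 T)).prod (volume.restrict (Ioc 0 T)))) :
    β * ∫ p in {p : ℝ × ℝ | p.1 < p.2}, (f p.2 - f p.1) / (p.2 - p.1) ^ (β + 1)
      ∂((volume.restrict (Ioc 0 T)).prod (volume.restrict (Ioc 0 T))) =
      (∫ s in (0 : ℝ)..T, f s / (T - s) ^ β) - ∫ s in (0 : ℝ)..T, f s / s ^ β := by
  set μ := (volume.restrict (Ioc (0 : ℝ) T)).prod (volume.restrict (Ioc (0 : ℝ) T)) with hμ
  set Δ := {p : ℝ × ℝ | p.1 < p.2} with hΔ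
  have hae : ∀ᵐ p ∂(μ.restrict Δ), p.1 ∈ Ioc 0 T ∧ p.2 ∈ Ioc 0 T ∧ p.1 < p.2 := by
    rw [hμ, Measure.prod_restrict, Measure.restrict_restrict measurableSet_fst_lt_snd]
    filter_upwards [ae_restrict_mem (measurableSet_fst_lt_snd.inter
      (measurableSet_Ioc.prod measurableSet_Ioc))] with p hp
    exact ⟨hp.2.1, hp.2.2, hp.1⟩
  let ε : ℕ → ℝ := fun n => 1 / ((n : ℝ) + 1)
  have hε : ∀ n, 0 < ε n := fun n => Nat.one_div_pos_of_nat
  have hε0 : Filter.Tendsto ε Filter.atTop (nhds 0) := tendsto_one_div_add_atTop_nhds_zero_nat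
  -- convergence of the truncated double integrals
  have lim1 : Filter.Tendsto (fun n => ∫ p in Δ, (f p.2 - f p.1) * (p.2 - p.1 + ε n) ^ (-(β + 1)) ∂μ)
      Filter.atTop (nhds (∫ p in Δ, (f p.2 - f p.1) / (p.2 - p.1) ^ (β + 1) ∂μ)) := by
    apply tendsto_integral_of_dominated_convergence _ _ hi.norm
    · intro n
      filter_upwards [hae] with p hp
      have hpos : 0 < p.2 - p.1 := sub_pos.2 hp.2.2
      rw [norm_mul, norm_div, div_eq_mul_inv, Real.norm_of_nonneg (Real.rpow_nonneg hpos.le _),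
        ← Real.rpow_neg hpos.le, Real.norm_of_nonneg (Real.rpow_nonneg (by linarith [hε n]) _)]
      exact mul_le_mul_of_nonneg_left
        (Real.rpow_le_rpow_of_nonpos hpos (by linarith [hε n]) (by linarith)) (norm_nonneg _)
    · filter_upwards [hae] with p hp
      have hpos : 0 < p.2 - p.1 := sub_pos.2 hp.2.2
      rw [div_eq_mul_inv, ← Real.rpow_neg hpos.le]
      apply Filter.Tendsto.const_mul
      have : ContinuousAt (fun e : ℝ => (p.2 - p.1 + e) ^ (-(β + 1))) 0 :=
        ContinuousAt.rpow_const (by fun_prop) (Or.inl (by rw [add_zero]; exact hpos.ne'))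
      have h2 := this.tendsto.comp hε0
      simpa [Function.comp_def] using h2
    · intro n
      exact Measurable.aestronglyMeasurable (by fun_prop)
  -- convergence of the single integrals
  have limAux : ∀ d : ℝ → ℝ, Measurable d → (∀ s ∈ Ioo 0 T, 0 < d s) →
      IntervalIntegrable (fun s => d s ^ (-β)) volume 0 T →
      Filter.Tendsto (fun n => ∫ s in (0 : ℝ)..T, f s * (d s + ε n) ^ (-β)) Filter.atTop
        (nhds (∫ s in (0 : ℝ)..T, f s / d s ^ β)) := by
    intro d hd hpos hint
    have hmem : ∀ᵐ s : ℝ ∂volume, s ∈ uIoc 0 T → s ∈ Ioo 0 T := by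
      filter_upwards [Measure.ae_ne volume T] with s hs hs2
      rw [uIoc_of_le hT] at hs2
      exact ⟨hs2.1, lt_of_le_of_ne hs2.2 hs⟩
    apply intervalIntegral.tendsto_integral_filter_of_dominated_convergence
      (fun s => B * d s ^ (-β))
    · exact Filter.Eventually.of_forall fun n => Measurable.aestronglyMeasurable (by fun_prop)
    · refine Filter.Eventually.of_forall fun n => ?_
      filter_upwards [hmem] with s hs hs2
      have hp := hpos s (hs hs2)
      rw [norm_mul, Real.norm_of_nonneg (Real.rpow_nonneg (by linarith [hε n]) _)]
      have hfB := hB s (Ioo_subset_Icc_self (hs hs2))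
      have := (abs_nonneg _).trans hfB
      have := Real.rpow_le_rpow_of_nonpos hp (show d s ≤ d s + ε n by linarith [hε n])
        (show -β ≤ 0 by linarith)
      have := Real.rpow_nonneg (show 0 ≤ d s + ε n by linarith [hε n]) (-β)
      rw [Real.norm_eq_abs]
      gcongr
    · exact hint.const_mul B
    · filter_upwards [hmem] with s hs hs2
      have hp := hpos s (hs hs2)
      rw [div_eq_mul_inv, ← Real.rpow_neg hp.le]
      apply Filter.Tendsto.const_mul
      have : ContinuousAt (fun e : ℝ => (d s + e) ^ (-β)) 0 :=
        ContinuousAt.rpow_const (by fun_prop) (Or.inl (by rw [add_zero]; exact hp.ne'))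
      have h2 := this.tendsto.comp hε0
      simpa [Function.comp_def] using h2
  have lim2 := limAux (fun s => T - s) (by fun_prop) (fun s hs => sub_pos.2 hs.2)
    (intervalIntegrable_sub_rpow_right (by linarith) 0 T)
  have lim3 := limAux (fun s => s) measurable_id (fun s hs => hs.1)
    (intervalIntegral.intervalIntegrable_rpow' (by linarith))
  -- It remains to prove the identity at fixed ε, where the kernel is bounded and the increment may
  -- be split.
  refine tendsto_nhds_unique (lim1.const_mul β) ((lim2.sub lim3).congr fun n => ?_)
  have hbd : ∀ᵐ p ∂(μ.restrict Δ), ‖(p.2 - p.1 + ε n) ^ (-(β + 1))‖ ≤ ε n ^ (-(β + 1)) := by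
    filter_upwards [hae] with p hp
    have hpos : 0 < p.2 - p.1 := sub_pos.2 hp.2.2
    rw [Real.norm_of_nonneg (Real.rpow_nonneg (by linarith [hε n]) _)]
    exact Real.rpow_le_rpow_of_nonpos (hε n) (by linarith) (by linarith)
  have iA : IntegrableOn (Function.uncurry fun u s => f s * (s - u + ε n) ^ (-(β + 1))) Δ μ := by
    refine Integrable.of_bound (Measurable.aestronglyMeasurable ?_) (B * ε n ^ (-(β + 1))) ?_
    · unfold Function.uncurry
      fun_prop
    · filter_upwards [hae, hbd] with p hp hb
      have h3 := hB p.2 (Ioc_subset_Icc_self hp.2.1)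
      have := (abs_nonneg _).trans h3
      simp only [Function.uncurry]
      rw [norm_mul]
      exact mul_le_mul h3 hb (norm_nonneg _) this
  have iB : IntegrableOn (Function.uncurry fun u s => f u * (s - u + ε n) ^ (-(β + 1))) Δ μ := by
    refine Integrable.of_bound (Measurable.aestronglyMeasurable ?_) (B * ε n ^ (-(β + 1))) ?_
    · unfold Function.uncurry
      fun_prop
    · filter_upwards [hae, hbd] with p hp hb
      have h3 := hB p.1 (Ioc_subset_Icc_self hp.1)
      have := (abs_nonneg _).trans h3
      simp only [Function.uncurry]
      rw [norm_mul]
      exact mul_le_mul h3 hb (norm_nonneg _) this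
  have fI : ∀ d : ℝ → ℝ, Continuous d → (∀ s ∈ Icc 0 T, 0 < d s) →
      IntervalIntegrable (fun s => f s * d s ^ (-β)) volume 0 T := by
    intro d hd hp
    have hf1 : IntervalIntegrable f volume 0 T := by
      rw [intervalIntegrable_iff_integrableOn_Ioc_of_le hT]
      refine Integrable.of_bound hf.aestronglyMeasurable B ?_
      filter_upwards [ae_restrict_mem measurableSet_Ioc] with s hs
      exact hB s (Ioc_subset_Icc_self hs)
    apply hf1.mul_continuousOn
    rw [uIcc_of_le hT]
    exact ContinuousOn.rpow_const hd.continuousOn fun s hs => Or.inl (hp s hs).ne'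
  have eA : ∫ p in Δ, Function.uncurry (fun u s => f s * (s - u + ε n) ^ (-(β + 1))) p ∂μ =
      ∫ s in (0 : ℝ)..T, (f s * (ε n ^ (-β) / β) - f s * (s + ε n) ^ (-β) / β) := by
    rw [integral_triangle_right hT iA]
    apply intervalIntegral.integral_congr
    intro s hs
    rw [uIcc_of_le hT] at hs
    simp only
    rw [intervalIntegral.integral_const_mul, integral_shifted_kernel' h0 (hε n) hs.1, sub_zero]
    ring
  have eB : ∫ p in Δ, Function.uncurry (fun u s => f u * (s - u + ε n) ^ (-(β + 1))) p ∂μ =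
      ∫ s in (0 : ℝ)..T, (f s * (ε n ^ (-β) / β) - f s * (T - s + ε n) ^ (-β) / β) := by
    rw [integral_triangle_left hT iB]
    apply intervalIntegral.integral_congr
    intro s hs
    rw [uIcc_of_le hT] at hs
    simp only
    rw [intervalIntegral.integral_const_mul, integral_shifted_kernel h0 (hε n) hs.2]
    ring
  have i0 : IntervalIntegrable (fun s => f s * (ε n ^ (-β) / β)) volume 0 T := by
    have := fI (fun _ => 1) continuous_const (fun _ _ => one_pos)
    simp only [Real.one_rpow, mul_one] at this
    exact this.mul_const _
  have i1 := fI (fun s => s + ε n) (by fun_prop) (fun s hs => by linarith [hε n, hs.1])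
  have i2 := fI (fun s => T - s + ε n) (by fun_prop) (fun s hs => by linarith [hε n, hs.2])
  have e3 : ∫ p in Δ, (f p.2 - f p.1) * (p.2 - p.1 + ε n) ^ (-(β + 1)) ∂μ =
      (∫ p in Δ, Function.uncurry (fun u s => f s * (s - u + ε n) ^ (-(β + 1))) p ∂μ) -
      ∫ p in Δ, Function.uncurry (fun u s => f u * (s - u + ε n) ^ (-(β + 1))) p ∂μ := by
    rw [← integral_sub iA iB]
    congr 1
    ext p
    simp only [Function.uncurry]
    ring
  rw [e3, eA, eB, intervalIntegral.integral_sub i0 (i1.div_const β),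
    intervalIntegral.integral_sub i0 (i2.div_const β), intervalIntegral.integral_div,
    intervalIntegral.integral_div]
  have alg : ∀ a b c : ℝ, c - b = β * (a - b / β - (a - c / β)) := by
    intro a b c
    field_simp
    ring
  exact alg _ _ _

/-- Fractional integration by parts for the Weyl derivatives. -/
lemma integral_weylLeft_mul {β T B : ℝ} (h0 : 0 < β) (h1 : β < 1) (hT : 0 ≤ T) {x K K' : ℝ → ℝ}
    (hx : Measurable x) (hB : ∀ s ∈ Icc 0 T, |x s| ≤ B)
    (hi : IntegrableOn (fun p : ℝ × ℝ => (x p.2 - x p.1) / (p.2 - p.1) ^ (β + 1))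
      {p | p.1 < p.2} ((volume.restrict (Ioc 0 T)).prod (volume.restrict (Ioc 0 T))))
    (hd : ∀ u, HasDerivAt K (K' u) u) (hc : Continuous K') :
    ∫ s in (0 : ℝ)..T, weylLeft β x s * K s = ∫ s in (0 : ℝ)..T, x s * weylRight β T K s := by
  obtain ⟨L, hL0, -, hL⟩ := exists_abs_sub_le_of_hasDerivAt hd hc 0 T
  have hK : Continuous K := continuous_iff_continuousAt.2 fun u => (hd u).continuousAt
  have hKm := hK.measurable
  obtain ⟨M, hM⟩ := isCompact_Icc.exists_bound_of_continuousOn (hK.continuousOn (s := Icc 0 T))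
  set μ := (volume.restrict (Ioc (0 : ℝ) T)).prod (volume.restrict (Ioc (0 : ℝ) T)) with hμ
  set Δ := {p : ℝ × ℝ | p.1 < p.2} with hΔ
  have hae : ∀ᵐ p ∂(μ.restrict Δ), p.1 ∈ Ioc 0 T ∧ p.2 ∈ Ioc 0 T ∧ p.1 < p.2 := by
    rw [hμ, Measure.prod_restrict, Measure.restrict_restrict measurableSet_fst_lt_snd]
    filter_upwards [ae_restrict_mem (measurableSet_fst_lt_snd.inter
      (measurableSet_Ioc.prod measurableSet_Ioc))] with p hp
    exact ⟨hp.2.1, hp.2.2, hp.1⟩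
  have iA : IntegrableOn (Function.uncurry fun u s => (x s - x u) / (s - u) ^ (β + 1) * K s) Δ μ := by
    refine (hi.norm.const_mul M).mono' (Measurable.aestronglyMeasurable ?_) ?_
    · unfold Function.uncurry
      fun_prop
    · filter_upwards [hae] with p hp
      simp only [Function.uncurry]
      rw [norm_mul, mul_comm]
      gcongr
      exact hM _ (Ioc_subset_Icc_self hp.2.1)
  have iD : IntegrableOn (Function.uncurry fun u s : ℝ => (s - u) ^ (-β)) Δ μ := by
    rw [← integrable_indicator_iff measurableSet_fst_lt_snd, integrable_prod_iff]
    · constructor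
      · filter_upwards [ae_restrict_mem measurableSet_Ioc] with u hu
        have := intervalIntegrable_sub_rpow_left (show -1 < -β by linarith) u T
        rw [intervalIntegrable_iff_integrableOn_Ioc_of_le hu.2,
          ← integrable_indicator_iff measurableSet_Ioc] at this
        refine (this.restrict (s := Ioc 0 T)).congr ?_
        filter_upwards [ae_restrict_mem measurableSet_Ioc] with s hs
        simp only [indicator, Function.uncurry, mem_Ioc, mem_ofPred_eq, hs.2, and_true]
      · have hcI : IntegrableOn (fun u : ℝ => (T - u) ^ (-β + 1) / (-β + 1)) (Ioc 0 T) := by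
          apply IntegrableOn.mono_set _ Ioc_subset_Icc_self
          apply ContinuousOn.integrableOn_Icc
          apply ContinuousOn.div_const
          exact ContinuousOn.rpow_const (by fun_prop) fun s hs => Or.inr (by linarith)
        refine Integrable.congr hcI ?_
        filter_upwards [ae_restrict_mem measurableSet_Ioc] with u hu
        rw [← integral_sub_rpow_left (by linarith), ← setIntegral_indicator_lt_right
          (F := fun u s : ℝ => (s - u) ^ (-β)) hu]
        congr 1
        ext s
        rw [Real.norm_of_nonneg]
        apply indicator_nonneg
        rintro ⟨u, s⟩ hp
        exact Real.rpow_nonneg (sub_nonneg.2 (le_of_lt hp)) _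
    · apply Measurable.aestronglyMeasurable
      apply Measurable.indicator _ measurableSet_fst_lt_snd
      unfold Function.uncurry
      fun_prop
  have iB : IntegrableOn (Function.uncurry fun u s => x u * ((K u - K s) / (s - u) ^ (β + 1))) Δ μ := by
    refine (iD.const_mul (B * L)).mono' (Measurable.aestronglyMeasurable ?_) ?_
    · unfold Function.uncurry
      fun_prop
    · filter_upwards [hae] with p hp
      have hpos : 0 < p.2 - p.1 := sub_pos.2 hp.2.2
      have hxB := hB p.1 (Ioc_subset_Icc_self hp.1)
      have hB0 := (abs_nonneg _).trans hxB
      simp only [Function.uncurry]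
      rw [norm_mul, norm_div, Real.norm_of_nonneg (Real.rpow_nonneg hpos.le (β + 1)), mul_assoc]
      refine mul_le_mul hxB ?_ (by positivity) hB0
      rw [div_le_iff₀ (by positivity), mul_assoc, ← Real.rpow_add hpos,
        show -β + (β + 1) = 1 by ring, Real.rpow_one]
      have := hL p.2 (Ioc_subset_Icc_self hp.2.1) p.1 (Ioc_subset_Icc_self hp.1)
      rwa [abs_sub_comm p.1, abs_of_pos hpos] at this
  -- Increment of the product xK: one term yields the left derivative of x times K, the other x
  -- times the right derivative of K. Applying `integral_increment_kernel` to xK moves the weight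
  -- s^{-β} to (T - s)^{-β}.
  have hfe : ∀ p : ℝ × ℝ, (x p.2 * K p.2 - x p.1 * K p.1) / (p.2 - p.1) ^ (β + 1) =
      Function.uncurry (fun u s => (x s - x u) / (s - u) ^ (β + 1) * K s) p -
      Function.uncurry (fun u s => x u * ((K u - K s) / (s - u) ^ (β + 1))) p := by
    intro p
    simp only [Function.uncurry]
    ring
  have hBM : ∀ s ∈ Icc 0 T, |x s * K s| ≤ B * M := by
    intro s hs
    rw [abs_mul]
    exact mul_le_mul (hB s hs) (hM s hs) (abs_nonneg _) ((abs_nonneg _).trans (hB s hs))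
  have key := integral_increment_kernel h0 h1 hT (f := fun s => x s * K s) (by fun_prop) hBM (by
    simp only [hfe]
    exact iA.sub iB)
  simp only [hfe] at key
  rw [integral_sub iA iB, integral_triangle_right hT iA, integral_triangle_left hT iB] at key
  have jA := intervalIntegrable_triangle_right hT iA
  have jB := intervalIntegrable_triangle_left hT iB
  have jx : ∀ d : ℝ → ℝ, Measurable d → (∀ s ∈ Ioc 0 T, 0 ≤ d s) →
      IntervalIntegrable (fun s => d s ^ (-β)) volume 0 T →
      IntervalIntegrable (fun s => x s * K s / d s ^ β) volume 0 T := by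
    intro d hdm hp hint
    rw [intervalIntegrable_iff_integrableOn_Ioc_of_le hT] at hint ⊢
    refine (hint.const_mul (B * M)).mono' (Measurable.aestronglyMeasurable (by fun_prop)) ?_
    filter_upwards [ae_restrict_mem measurableSet_Ioc] with s hs
    rw [Real.rpow_neg (hp s hs), ← div_eq_mul_inv, norm_div,
      Real.norm_of_nonneg (Real.rpow_nonneg (hp s hs) β)]
    have h5 := hp s hs
    gcongr
    exact hBM s (Ioc_subset_Icc_self hs)
  have j1 := jx (fun s => s) measurable_id (fun s hs => hs.1.le)
    (intervalIntegral.intervalIntegrable_rpow' (by linarith))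
  have j2 := jx (fun s => T - s) (by fun_prop) (fun s hs => sub_nonneg.2 hs.2)
    (intervalIntegrable_sub_rpow_right (by linarith) 0 T)
  have eL : ∫ s in (0 : ℝ)..T, weylLeft β x s * K s = (Real.Gamma (1 - β))⁻¹ *
      ((∫ s in (0 : ℝ)..T, x s * K s / s ^ β) +
        β * ∫ s in (0 : ℝ)..T, ∫ u in (0 : ℝ)..s, (x s - x u) / (s - u) ^ (β + 1) * K s) := by
    rw [← intervalIntegral.integral_const_mul β, ← intervalIntegral.integral_add j1 (jA.const_mul β),
      ← intervalIntegral.integral_const_mul]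
    congr 1
    ext s
    unfold weylLeft
    rw [intervalIntegral.integral_mul_const]
    ring
  have eR : ∫ s in (0 : ℝ)..T, x s * weylRight β T K s = (Real.Gamma (1 - β))⁻¹ *
      ((∫ s in (0 : ℝ)..T, x s * K s / (T - s) ^ β) +
        β * ∫ s in (0 : ℝ)..T, ∫ u in s..T, x s * ((K s - K u) / (u - s) ^ (β + 1))) := by
    rw [← intervalIntegral.integral_const_mul β, ← intervalIntegral.integral_add j2 (jB.const_mul β),
      ← intervalIntegral.integral_const_mul]
    congr 1
    ext s
    unfold weylRight
    rw [intervalIntegral.integral_const_mul]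
    ring
  rw [eL, eR]
  linear_combination (Real.Gamma (1 - β))⁻¹ * key

/-- For a smooth integrator that is constant after `T`, the generalized Lebesgue–Stieltjes integral
is the integral against the derivative. -/
lemma integral_glsIntegrand_of_hasDerivAt {β T B : ℝ} (h0 : 0 < β) (h1 : β < 1) (hT : 0 ≤ T)
    {x h φ φ' : ℝ → ℝ} (hx : Measurable x) (hB : ∀ s ∈ Icc 0 T, |x s| ≤ B)
    (hi : IntegrableOn (fun p : ℝ × ℝ => (x p.2 - x p.1) / (p.2 - p.1) ^ (β + 1))
      {p | p.1 < p.2} ((volume.restrict (Ioc 0 T)).prod (volume.restrict (Ioc 0 T))))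
    (hh : ∀ u, HasDerivAt h (φ u) u) (hd : ∀ u, HasDerivAt φ (φ' u) u) (hc : Continuous φ')
    (hz : ∀ u, T ≤ u → φ u = 0) (hz' : ∀ u, T ≤ u → φ' u = 0) :
    ∫ s in (0 : ℝ)..T, glsIntegrand T β x h s = ∫ s in (0 : ℝ)..T, x s * φ s := by
  have hφ : Continuous φ := continuous_iff_continuousAt.2 fun u => (hd u).continuousAt
  have hΓ : Real.Gamma β ≠ 0 := (Real.Gamma_pos_of_pos h0).ne'
  have hmem : ∀ᵐ s : ℝ ∂volume, s ∈ uIoc 0 T → s ∈ Ioo 0 T := by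
    filter_upwards [Measure.ae_ne volume T] with s hs hs2
    rw [uIoc_of_le hT] at hs2
    exact ⟨hs2.1, lt_of_le_of_ne hs2.2 hs⟩
  -- The right derivative of order 1-β of h - h(T) is minus the right fractional integral of order β
  -- of φ; this sign cancels the one in `glsIntegrand`.
  have e1 : ∫ s in (0 : ℝ)..T, glsIntegrand T β x h s =
      ∫ s in (0 : ℝ)..T, (Real.Gamma β)⁻¹ * (weylLeft β x s * rightPotential β T φ s) := by
    apply intervalIntegral.integral_congr_ae
    filter_upwards [hmem] with s hs hs2
    have hs := hs hs2
    unfold glsIntegrand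
    rw [weylRight_eq_of_hasDerivAt (by linarith) hs.2 (fun u => (hh u).sub_const (h T)) hφ
      (sub_self _), rightPotential_eq h0 (Ioo_subset_Icc_self hs) hφ hz, sub_sub_cancel, neg_sub]
    ring
  rw [e1, intervalIntegral.integral_const_mul, integral_weylLeft_mul h0 h1 hT hx hB hi
    (fun s => hasDerivAt_rightPotential h0 hT hd hc s) (continuous_rightPotential h0 hT hc),
    ← intervalIntegral.integral_const_mul]
  apply intervalIntegral.integral_congr_ae
  filter_upwards [hmem] with s hs hs2
  rw [weylRight_rightPotential h0 h1 (Ioo_subset_Ico_self (hs hs2)) hd hc hz hz']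
  field_simp

/-! ### Paths with an integrable local modulus of oscillation -/

/-- `w t r` bounds the oscillation of the path `x` on the part of `[0,T]` at distance at most `r`
from `t`, and has fractional moments of every order below `α`. -/
structure IsOscillationModulus (T α : ℝ) (x : ℝ → ℝ) (w : ℝ → ℝ → ℝ≥0∞) : Prop where
  measurable : Measurable (Function.uncurry w)
  le : ∀ t ∈ Icc 0 T, ∀ s ∈ Icc 0 T, ∀ s' ∈ Icc 0 T, ∀ r, |s - t| ≤ r → |s' - t| ≤ r →
    ENNReal.ofReal |x s - x s'| ≤ w t r
  mono : ∀ t, MonotoneOn (w t) (Ici 0)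
  lintegral_lt_top : ∀ q < α, ∫⁻ t in Ioc 0 T, ∫⁻ r in Ioc 0 (2 * T),
    w t r * ENNReal.ofReal (r ^ (-(q + 1))) < ∞

section Left

variable {T α β B : ℝ} {x : ℝ → ℝ} {w : ℝ → ℝ → ℝ≥0∞}

lemma setLIntegral_Ioo_sub_left (F : ℝ → ℝ≥0∞) (s : ℝ) :
    ∫⁻ u in Ioo 0 s, F (s - u) = ∫⁻ r in Ioo 0 s, F r := by
  rw [← lintegral_indicator measurableSet_Ioo, ← lintegral_indicator measurableSet_Ioo,
    ← lintegral_sub_left_eq_self ((Ioo 0 s).indicator F) s]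
  congr 1
  ext u
  by_cases h : u ∈ Ioo 0 s
  · rw [indicator_of_mem h, indicator_of_mem (by constructor <;> linarith [h.1, h.2])]
  · rw [indicator_of_notMem h, indicator_of_notMem]
    intro h'
    exact h (by constructor <;> linarith [h'.1, h'.2])

/-- With r = s - u the increment is at most w(s,r), so the seminorm is dominated by the moment of
order β of the modulus. -/
lemma lintegral_increment_lt_top (hw : IsOscillationModulus T α x w) (hβ : β < α) :
    ∫⁻ s in Ioc 0 T, ∫⁻ u in Ioo 0 s, ENNReal.ofReal (|x u - x s| / (s - u) ^ (1 + β)) < ∞ := by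
  refine lt_of_le_of_lt ?_ (hw.lintegral_lt_top β hβ)
  refine setLIntegral_mono' measurableSet_Ioc fun s hs => ?_
  calc ∫⁻ u in Ioo 0 s, ENNReal.ofReal (|x u - x s| / (s - u) ^ (1 + β))
      ≤ ∫⁻ u in Ioo 0 s, w s (s - u) * ENNReal.ofReal ((s - u) ^ (-(β + 1))) := by
        refine setLIntegral_mono' measurableSet_Ioo fun u hu => ?_
        have hpos : 0 < s - u := sub_pos.2 hu.2
        rw [div_eq_mul_inv, ← Real.rpow_neg hpos.le, ENNReal.ofReal_mul (abs_nonneg _),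
          add_comm 1 β]
        gcongr
        refine hw.le s (Ioc_subset_Icc_self hs) u ⟨hu.1.le, hu.2.le.trans hs.2⟩ s
          (Ioc_subset_Icc_self hs) _ ?_ ?_
        · rw [abs_sub_comm, abs_of_pos hpos]
        · simpa using hpos.le
    _ = ∫⁻ r in Ioo 0 s, w s r * ENNReal.ofReal (r ^ (-(β + 1))) :=
        setLIntegral_Ioo_sub_left (fun r => w s r * ENNReal.ofReal (r ^ (-(β + 1)))) s
    _ ≤ _ := lintegral_mono_set (show Ioo 0 s ⊆ Ioc 0 (2 * T) from
        fun r hr => ⟨hr.1, by linarith [hr.1, hr.2, hs.1, hs.2]⟩)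

lemma integrableOn_increment (hx : Measurable x) (hw : IsOscillationModulus T α x w)
    (hβ : β < α) :
    IntegrableOn (fun p : ℝ × ℝ => (x p.2 - x p.1) / (p.2 - p.1) ^ (β + 1))
      {p | p.1 < p.2} ((volume.restrict (Ioc 0 T)).prod (volume.restrict (Ioc 0 T))) := by
  have hm : Measurable fun p : ℝ × ℝ => (x p.2 - x p.1) / (p.2 - p.1) ^ (β + 1) := by fun_prop
  refine ⟨hm.aestronglyMeasurable, ?_⟩
  unfold HasFiniteIntegral
  rw [← lintegral_indicator measurableSet_fst_lt_snd, lintegral_prod_symm']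
  swap
  · exact Measurable.indicator (by fun_prop) measurableSet_fst_lt_snd
  refine lt_of_eq_of_lt ?_ (lintegral_increment_lt_top hw hβ)
  refine setLIntegral_congr_fun measurableSet_Ioc fun s hs => ?_
  simp only
  rw [← lintegral_indicator measurableSet_Ioc, ← lintegral_indicator measurableSet_Ioo]
  congr 1
  ext u
  by_cases h : u ∈ Ioo 0 s
  · have hpos : 0 < s - u := sub_pos.2 h.2
    rw [indicator_of_mem h, indicator_of_mem (show u ∈ Ioc 0 T from ⟨h.1, h.2.le.trans hs.2⟩),
      indicator_of_mem (show (u, s) ∈ {p : ℝ × ℝ | p.1 < p.2} from h.2), Real.enorm_eq_ofReal_abs,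
      abs_div, abs_of_nonneg (Real.rpow_nonneg hpos.le _), abs_sub_comm, add_comm]
  · rw [indicator_of_notMem h]
    by_cases h2 : u ∈ Ioc 0 T
    · rw [indicator_of_mem h2, indicator_of_notMem]
      intro h3
      exact h ⟨h2.1, h3⟩
    · rw [indicator_of_notMem h2]

lemma intervalIntegrable_div_rpow (h1 : β < 1) (hT : 0 ≤ T) (hx : Measurable x)
    (hB : ∀ s ∈ Icc 0 T, |x s| ≤ B) : IntervalIntegrable (fun s => x s / s ^ β) volume 0 T := by
  refine intervalIntegrable_of_abs_le_rpow (c := -β) (M := B) hT (by linarith)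
    (Measurable.aestronglyMeasurable (by fun_prop)) fun s hs => ?_
  rw [sub_zero, abs_div, abs_of_nonneg (Real.rpow_nonneg hs.1.le _), Real.rpow_neg hs.1.le,
    ← div_eq_mul_inv]
  have := Real.rpow_nonneg hs.1.le β
  gcongr
  exact hB s (Ioc_subset_Icc_self hs)

lemma memBesov₂_of_isOscillationModulus (h1 : β < 1) (hT : 0 ≤ T) (hx : Measurable x)
    (hB : ∀ s ∈ Icc 0 T, |x s| ≤ B) (hw : IsOscillationModulus T α x w) (hβ : β < α) :
    MemBesov₂ T β x := by
  refine ⟨hx.comp measurable_subtype_coe, ENNReal.add_lt_top.2 ⟨?_,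
    lintegral_increment_lt_top hw hβ⟩⟩
  have h := (intervalIntegrable_div_rpow h1 hT hx hB).1.2
  refine lt_of_eq_of_lt (setLIntegral_congr_fun measurableSet_Ioc fun s hs => ?_) h
  simp only
  rw [Real.enorm_eq_ofReal_abs, abs_div, abs_of_nonneg (Real.rpow_nonneg hs.1.le _)]

lemma intervalIntegrable_weylLeft (h1 : β < 1) (hT : 0 ≤ T) (hx : Measurable x)
    (hB : ∀ s ∈ Icc 0 T, |x s| ≤ B) (hw : IsOscillationModulus T α x w) (hβ : β < α) :
    IntervalIntegrable (weylLeft β x) volume 0 T :=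
  ((intervalIntegrable_div_rpow h1 hT hx hB).add
    ((intervalIntegrable_triangle_right (F := fun u s => (x s - x u) / (s - u) ^ (β + 1)) hT
      (integrableOn_increment hx hw hβ)).const_mul β)).const_mul _

end Left

/-! ### Weyl derivatives of Hölder continuous integrators -/

section Right

variable {T β γ δ C : ℝ} {x y : ℝ → ℝ}

lemma abs_increment_kernel_le (hy : ∀ s t, |y t - y s| ≤ C * |t - s| ^ γ) {s u : ℝ} (hu : s < u) :
    |(y s - y u) / (u - s) ^ (δ + 1)| ≤ C * (u - s) ^ (γ - δ - 1) := by
  have hpos : 0 < u - s := sub_pos.2 hu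
  rw [abs_div, abs_of_pos (Real.rpow_pos_of_pos hpos (δ + 1)), div_le_iff₀ (by positivity),
    mul_assoc, ← Real.rpow_add hpos, show γ - δ - 1 + (δ + 1) = γ by ring, abs_sub_comm]
  simpa [abs_of_pos hpos] using hy s u

/-- Hölder continuity leaves the kernel (u - s)^{γ-δ-1}, integrable since δ < γ. The bound involves
y only through C and γ, hence is uniform along the smooth approximations. -/
lemma abs_weylRight_le (hy : ∀ s t, |y t - y s| ≤ C * |t - s| ^ γ)
    (hC : 0 ≤ C) (h0 : 0 < δ) (h1 : δ < 1) (hδ : δ < γ) {s : ℝ} (hs : s ∈ Ioo 0 T) :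
    |weylRight δ T (fun u => y u - y T) s| ≤
      (Real.Gamma (1 - δ))⁻¹ * (C * T ^ (γ - δ) + δ * (C * (T ^ (γ - δ) / (γ - δ)))) := by
  have hpos : 0 < T - s := sub_pos.2 hs.2
  have hΓ := Real.Gamma_pos_of_pos (show 0 < 1 - δ by linarith)
  have hTs : (T - s) ^ (γ - δ) ≤ T ^ (γ - δ) :=
    Real.rpow_le_rpow hpos.le (by linarith [hs.1]) (by linarith)
  have hγδ : 0 < γ - δ := sub_pos.2 hδ
  unfold weylRight
  rw [abs_mul, abs_of_pos (inv_pos.2 hΓ)]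
  gcongr
  refine (abs_add_le _ _).trans (add_le_add ?_ ?_)
  · have h2 : |(y s - y T) / (T - s) ^ δ| ≤ C * (T - s) ^ (γ - δ) := by
      rw [abs_div, abs_of_pos (Real.rpow_pos_of_pos hpos δ), div_le_iff₀ (by positivity),
        mul_assoc, ← Real.rpow_add hpos, sub_add_cancel, abs_sub_comm]
      simpa [abs_of_pos hpos] using hy s T
    exact h2.trans (by gcongr)
  · rw [abs_mul, abs_of_pos h0]
    gcongr
    simp only [sub_sub_sub_cancel_right]
    have h3 := intervalIntegral.norm_integral_le_of_norm_le hs.2.le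
      (f := fun u => (y s - y u) / (u - s) ^ (δ + 1)) (g := fun u => C * (u - s) ^ (γ - δ - 1))
      (Filter.Eventually.of_forall fun u hu => abs_increment_kernel_le hy hu.1)
      ((intervalIntegrable_sub_rpow_left (by linarith) s T).const_mul C)
    rw [intervalIntegral.integral_const_mul, integral_sub_rpow_left (by linarith),
      show γ - δ - 1 + 1 = γ - δ by ring] at h3
    refine h3.trans ?_
    gcongr

lemma aestronglyMeasurable_weylRight (hym : Measurable y) :
    AEStronglyMeasurable (weylRight δ T y) (volume.restrict (Ioc 0 T)) := by
  have h := aestronglyMeasurable_integral_right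
    (F := fun s u => (y s - y u) / (u - s) ^ (δ + 1)) (by unfold Function.uncurry; fun_prop) 0 T
  have h2 : AEStronglyMeasurable (fun s => y s / (T - s) ^ δ) (volume.restrict (Ioc 0 T)) :=
    Measurable.aestronglyMeasurable (by fun_prop)
  exact (h2.add (h.const_mul δ)).const_mul _

lemma memBesov₁_of_holder (hy : ∀ s t, |y t - y s| ≤ C * |t - s| ^ γ)
    (hC : 0 ≤ C) (hym : Measurable y) (hδ : δ < γ) : MemBesov₁ T δ y := by
  have hγδ : 0 < γ - δ := sub_pos.2 hδ
  refine ⟨hym.comp measurable_subtype_coe, ?_⟩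
  refine lt_of_le_of_lt (b := ENNReal.ofReal (C * T ^ (γ - δ)) +
    ENNReal.ofReal (C * (T ^ (γ - δ) / (γ - δ)))) ?_
    (ENNReal.add_lt_top.2 ⟨ENNReal.ofReal_lt_top, ENNReal.ofReal_lt_top⟩)
  unfold besovNorm₁
  refine iSup_le fun s => iSup_le fun t => iSup_le fun hst => ?_
  have hpos : 0 < t - s := sub_pos.2 hst.2.1
  have hTs : (t - s) ^ (γ - δ) ≤ T ^ (γ - δ) :=
    Real.rpow_le_rpow hpos.le (by linarith [hst.1, hst.2.2]) (by linarith)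
  refine add_le_add (ENNReal.ofReal_le_ofReal ?_) ?_
  · have h2 : |y t - y s| / (t - s) ^ δ ≤ C * (t - s) ^ (γ - δ) := by
      rw [div_le_iff₀ (by positivity), mul_assoc, ← Real.rpow_add hpos, sub_add_cancel]
      simpa [abs_of_pos hpos] using hy s t
    exact h2.trans (by gcongr)
  · calc ∫⁻ u in Ioc s t, ENNReal.ofReal (|y u - y s| / (u - s) ^ (1 + δ))
        ≤ ∫⁻ u in Ioc s t, ENNReal.ofReal (C * (u - s) ^ (γ - δ - 1)) := by
          refine setLIntegral_mono' measurableSet_Ioc fun u hu => ENNReal.ofReal_le_ofReal ?_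
          have h5 := abs_increment_kernel_le (δ := δ) hy hu.1
          rwa [abs_div, abs_of_nonneg (Real.rpow_nonneg (sub_nonneg.2 hu.1.le) _), abs_sub_comm,
            add_comm] at h5
      _ = ENNReal.ofReal (∫ u in Ioc s t, C * (u - s) ^ (γ - δ - 1)) := by
          rw [ofReal_integral_eq_lintegral_ofReal]
          · exact ((intervalIntegrable_sub_rpow_left (by linarith) s t).const_mul C).1
          · filter_upwards [ae_restrict_mem measurableSet_Ioc] with u hu
            have := Real.rpow_nonneg (sub_nonneg.2 hu.1.le) (γ - δ - 1)
            exact mul_nonneg hC this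
      _ ≤ _ := by
          rw [← intervalIntegral.integral_of_le hst.2.1.le, intervalIntegral.integral_const_mul,
            integral_sub_rpow_left (by linarith), show γ - δ - 1 + 1 = γ - δ by ring]
          gcongr

lemma ae_mem_uIoc_imp_mem_Ioo (hT : 0 ≤ T) : ∀ᵐ s : ℝ ∂volume, s ∈ uIoc 0 T → s ∈ Ioo 0 T := by
  filter_upwards [Measure.ae_ne volume T] with s hs hs2
  rw [uIoc_of_le hT] at hs2
  exact ⟨hs2.1, lt_of_le_of_ne hs2.2 hs⟩

/-- The product of an L¹ function and a bounded one; β > 1-γ is what makes the second factor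
bounded. -/
lemma intervalIntegrable_glsIntegrand (hy : ∀ s t, |y t - y s| ≤ C * |t - s| ^ γ)
    (hC : 0 ≤ C) (hym : Measurable y) (hT : 0 ≤ T) (h0 : 0 < β) (h1 : β < 1) (hβ : 1 - β < γ)
    (hx : IntervalIntegrable (weylLeft β x) volume 0 T) :
    IntervalIntegrable (glsIntegrand T β x y) volume 0 T := by
  have hi := (hx.norm).mul_const ((Real.Gamma (1 - (1 - β)))⁻¹ *
    (C * T ^ (γ - (1 - β)) + (1 - β) * (C * (T ^ (γ - (1 - β)) / (γ - (1 - β))))))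
  rw [intervalIntegrable_iff_integrableOn_Ioc_of_le hT] at hi hx ⊢
  refine hi.mono' (hx.1.mul (aestronglyMeasurable_weylRight (by fun_prop))).neg ?_
  rw [ae_restrict_iff' measurableSet_Ioc]
  filter_upwards [ae_mem_uIoc_imp_mem_Ioo hT] with s hs hs2
  rw [uIoc_of_le hT] at hs
  unfold glsIntegrand
  rw [norm_neg, norm_mul]
  exact mul_le_mul_of_nonneg_left
    (abs_weylRight_le hy hC (by linarith) (by linarith) hβ (hs hs2)) (norm_nonneg _)

lemma tendsto_weylRight {yn : ℕ → ℝ → ℝ} (hyn : ∀ n s t, |yn n t - yn n s| ≤ C * |t - s| ^ γ)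
    (hym : ∀ n, Measurable (yn n)) (hδ : δ < γ)
    (hlim : ∀ t, Filter.Tendsto (fun n => yn n t) Filter.atTop (nhds (y t))) {s : ℝ} (hs : s ≤ T) :
    Filter.Tendsto (fun n => weylRight δ T (fun u => yn n u - yn n T) s) Filter.atTop
      (nhds (weylRight δ T (fun u => y u - y T) s)) := by
  unfold weylRight
  simp only [sub_sub_sub_cancel_right]
  apply Filter.Tendsto.const_mul
  apply Filter.Tendsto.add
  · exact ((hlim s).sub (hlim T)).div_const _
  · apply Filter.Tendsto.const_mul
    apply intervalIntegral.tendsto_integral_filter_of_dominated_convergence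
      (fun u => C * (u - s) ^ (γ - δ - 1))
    · refine Filter.Eventually.of_forall fun n => Measurable.aestronglyMeasurable ?_
      have := hym n
      fun_prop
    · refine Filter.Eventually.of_forall fun n => Filter.Eventually.of_forall fun u hu => ?_
      rw [uIoc_of_le hs] at hu
      exact abs_increment_kernel_le (hyn n) hu.1
    · exact (intervalIntegrable_sub_rpow_left (by linarith) s T).const_mul C
    · exact Filter.Eventually.of_forall fun u _ => ((hlim s).sub (hlim u)).div_const _

/-- The common Hölder constant gives one bound for all right derivatives, so a multiple of |D^β x|
dominates. -/
lemma tendsto_integral_glsIntegrand {yn : ℕ → ℝ → ℝ}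
    (hyn : ∀ n s t, |yn n t - yn n s| ≤ C * |t - s| ^ γ) (hC : 0 ≤ C)
    (hym : ∀ n, Measurable (yn n)) (hT : 0 ≤ T) (h0 : 0 < β) (h1 : β < 1) (hβ : 1 - β < γ)
    (hlim : ∀ t, Filter.Tendsto (fun n => yn n t) Filter.atTop (nhds (y t)))
    (hx : IntervalIntegrable (weylLeft β x) volume 0 T) :
    Filter.Tendsto (fun n => ∫ s in (0 : ℝ)..T, glsIntegrand T β x (yn n) s) Filter.atTop
      (nhds (∫ s in (0 : ℝ)..T, glsIntegrand T β x y s)) := by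
  apply intervalIntegral.tendsto_integral_filter_of_dominated_convergence
    (fun s => ‖weylLeft β x s‖ * ((Real.Gamma (1 - (1 - β)))⁻¹ *
    (C * T ^ (γ - (1 - β)) + (1 - β) * (C * (T ^ (γ - (1 - β)) / (γ - (1 - β)))))))
  · refine Filter.Eventually.of_forall fun n => ?_
    rw [uIoc_of_le hT]
    exact (intervalIntegrable_glsIntegrand (hyn n) hC (hym n) hT h0 h1 hβ hx).1.1
  · refine Filter.Eventually.of_forall fun n => ?_
    filter_upwards [ae_mem_uIoc_imp_mem_Ioo hT] with s hs hs2
    unfold glsIntegrand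
    rw [norm_neg, norm_mul]
    exact mul_le_mul_of_nonneg_left
      (abs_weylRight_le (hyn n) hC (by linarith) (by linarith) hβ (hs hs2)) (norm_nonneg _)
  · exact hx.norm.mul_const _
  · filter_upwards [ae_mem_uIoc_imp_mem_Ioo hT] with s hs hs2
    exact ((tendsto_weylRight hyn hym hβ hlim (hs hs2).2.le).const_mul _).neg

end Right

/-! ### Riemann–Stieltjes sums against a smooth integrator -/

section Cells

variable {T α γ C M : ℝ} {x h h' : ℝ → ℝ} {w : ℝ → ℝ → ℝ≥0∞}

/-- On (ℓ, 2ℓ] the modulus is at least w(t,ℓ) and the weight at least (2ℓ)^{γ-2}; the interval has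
length ℓ. The constant 4 bounds 2^{2-γ}. -/
lemma modulus_le_lintegral (hw : IsOscillationModulus T α x w) (hγ : 0 ≤ γ) (hγ' : γ ≤ 1) {ℓ : ℝ}
    (hℓ : 0 < ℓ) (t : ℝ) :
    w t ℓ * ENNReal.ofReal (ℓ ^ (γ - 1)) ≤
      4 * ∫⁻ r in Ioc ℓ (2 * ℓ), w t r * ENNReal.ofReal (r ^ (γ - 2)) := by
  have h1 : ∫⁻ _ in Ioc ℓ (2 * ℓ), w t ℓ * ENNReal.ofReal ((2 * ℓ) ^ (γ - 2)) ≤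
      ∫⁻ r in Ioc ℓ (2 * ℓ), w t r * ENNReal.ofReal (r ^ (γ - 2)) := by
    refine setLIntegral_mono' measurableSet_Ioc fun r hr => ?_
    have hr0 : 0 < r := hℓ.trans hr.1
    exact mul_le_mul' (hw.mono t hℓ.le hr0.le hr.1.le)
      (ENNReal.ofReal_le_ofReal (Real.rpow_le_rpow_of_nonpos hr0 hr.2 (by linarith)))
  rw [setLIntegral_const, Real.volume_Ioc, mul_assoc, ← ENNReal.ofReal_mul (by positivity)] at h1
  have h2 : ℓ ^ (γ - 1) ≤ 4 * ((2 * ℓ) ^ (γ - 2) * (2 * ℓ - ℓ)) := by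
    have e1 : (1 : ℝ) ≤ 4 * 2 ^ (γ - 2) := by
      have : (2 : ℝ) ^ (-2 : ℝ) ≤ 2 ^ (γ - 2) :=
        Real.rpow_le_rpow_of_exponent_le (by norm_num) (by linarith)
      have e2 : (2 : ℝ) ^ (-2 : ℝ) = 1 / 4 := by
        rw [Real.rpow_neg (by norm_num)]
        norm_num
      rw [e2] at this
      linarith
    rw [Real.mul_rpow (by norm_num) hℓ.le, show γ - 1 = γ - 2 + 1 by ring, Real.rpow_add hℓ,
      Real.rpow_one]
    have : 0 ≤ ℓ ^ (γ - 2) * ℓ := by positivity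
    nlinarith
  calc w t ℓ * ENNReal.ofReal (ℓ ^ (γ - 1))
      ≤ w t ℓ * ENNReal.ofReal (4 * ((2 * ℓ) ^ (γ - 2) * (2 * ℓ - ℓ))) := by gcongr
    _ = 4 * (w t ℓ * ENNReal.ofReal ((2 * ℓ) ^ (γ - 2) * (2 * ℓ - ℓ))) := by
        rw [ENNReal.ofReal_mul (by norm_num), ENNReal.ofReal_ofNat]
        ring
    _ ≤ _ := by gcongr

/-- The error of a one-point approximation of `∫ x dh` over a cell of length `ℓ`. -/
noncomputable def cellBound (γ : ℝ) (w : ℝ → ℝ → ℝ≥0∞) (a b ℓ : ℝ) : ℝ≥0∞ :=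
  ∫⁻ t in Ioc a b, ∫⁻ r in Ioc 0 ℓ, w t r * ENNReal.ofReal (r ^ (γ - 2))

lemma measurable_modulus_mul (hw : IsOscillationModulus T α x w) :
    Measurable (Function.uncurry fun t r => w t r * ENNReal.ofReal (r ^ (γ - 2))) := by
  have := hw.measurable
  unfold Function.uncurry at this ⊢
  fun_prop

lemma measurable_lintegral_modulus (hw : IsOscillationModulus T α x w) (s : Set ℝ) :
    Measurable fun t => ∫⁻ r in s, w t r * ENNReal.ofReal (r ^ (γ - 2)) :=
  (measurable_modulus_mul hw).lintegral_prod_right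

lemma lintegral_Ioc_add_adjacent (f : ℝ → ℝ≥0∞) {a m b : ℝ} (h1 : a ≤ m) (h2 : m ≤ b) :
    ∫⁻ t in Ioc a b, f t = (∫⁻ t in Ioc a m, f t) + ∫⁻ t in Ioc m b, f t := by
  rw [← Ioc_union_Ioc_eq_Ioc h1 h2, lintegral_union measurableSet_Ioc (Ioc_disjoint_Ioc_of_le le_rfl)]

/-- The two halves use radii up to ℓ, and the bisection costs the radii in (ℓ, 2ℓ]. Errors from
successive bisections therefore fill disjoint scales and add up without loss. -/
lemma cellBound_bisect (hw : IsOscillationModulus T α x w) {a m b ℓ : ℝ} (h1 : a ≤ m) (h2 : m ≤ b)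
    (hℓ : 0 ≤ ℓ) :
    cellBound γ w a m ℓ + cellBound γ w m b ℓ +
      ∫⁻ t in Ioc a b, ∫⁻ r in Ioc ℓ (2 * ℓ), w t r * ENNReal.ofReal (r ^ (γ - 2)) =
      cellBound γ w a b (2 * ℓ) := by
  unfold cellBound
  rw [← lintegral_Ioc_add_adjacent _ h1 h2, ← lintegral_add_left (measurable_lintegral_modulus hw _)]
  congr 1
  ext t
  rw [← lintegral_Ioc_add_adjacent _ hℓ (by linarith)]

lemma ofReal_abs_add_le (a b : ℝ) :
    ENNReal.ofReal |a + b| ≤ ENNReal.ofReal |a| + ENNReal.ofReal |b| := by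
  rw [← ENNReal.ofReal_add (abs_nonneg _) (abs_nonneg _)]
  exact ENNReal.ofReal_le_ofReal (abs_add_le a b)

/-- The error is the integral of (x s - x ξ) h'. The constant M is not uniform over approximations
of y, so this crude estimate serves only at the finest scale of the bisection. -/
lemma cell_error_le_of_lipschitz (hw : IsOscillationModulus T α x w) (hx : Measurable x) {B : ℝ}
    (hB : ∀ s ∈ Icc 0 T, |x s| ≤ B)
    (hd : ∀ u, HasDerivAt h (h' u) u) (hc : Continuous h') (hM : ∀ u ∈ Icc 0 T, |h' u| ≤ M)
    {a b ξ : ℝ} (ha : 0 ≤ a) (hb : b ≤ T) (hξ : ξ ∈ Icc a b) :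
    ENNReal.ofReal |(∫ s in a..b, x s * h' s) - x ξ * (h b - h a)| ≤
      ENNReal.ofReal M * ∫⁻ t in Ioc a b, w t (b - a) := by
  have hab : a ≤ b := hξ.1.trans hξ.2
  have hi : IntervalIntegrable x volume a b := by
    rw [intervalIntegrable_iff_integrableOn_Ioc_of_le hab]
    refine Integrable.of_bound hx.aestronglyMeasurable B ?_
    filter_upwards [ae_restrict_mem measurableSet_Ioc] with s hs
    exact hB s ⟨ha.trans hs.1.le, hs.2.trans hb⟩
  have hi2 : IntervalIntegrable (fun s => x s * h' s) volume a b := hi.mul_continuousOn hc.continuousOn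
  have hi3 : IntervalIntegrable (fun s => x ξ * h' s) volume a b :=
    (hc.intervalIntegrable _ _).const_mul _
  have e : (∫ s in a..b, x s * h' s) - x ξ * (h b - h a) =
      ∫ s in Ioc a b, (x s * h' s - x ξ * h' s) := by
    rw [← intervalIntegral.integral_of_le hab, intervalIntegral.integral_sub hi2 hi3,
      intervalIntegral.integral_const_mul, intervalIntegral.integral_eq_sub_of_hasDerivAt
        (fun s _ => hd s) (hc.intervalIntegrable _ _)]
  rw [e, ← Real.enorm_eq_ofReal_abs]
  refine (enorm_integral_le_lintegral_enorm _).trans ?_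
  rw [← lintegral_const_mul' _ _ ENNReal.ofReal_ne_top]
  refine setLIntegral_mono' measurableSet_Ioc fun s hs => ?_
  have hs' : s ∈ Icc 0 T := ⟨ha.trans hs.1.le, hs.2.trans hb⟩
  rw [← sub_mul, Real.enorm_eq_ofReal_abs, abs_mul, mul_comm, ENNReal.ofReal_mul (abs_nonneg _)]
  refine mul_le_mul' (ENNReal.ofReal_le_ofReal (hM s hs')) ?_
  refine hw.le s hs' s hs' ξ ⟨ha.trans hξ.1, hξ.2.trans hb⟩ _ ?_ ?_
  · simpa using hab
  · rw [abs_le]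
    constructor <;> linarith [hξ.1, hξ.2, hs.1, hs.2]

/-- Each of the n bisections is paid for with the Hölder constant C through its own range of radii.
The derivative bound M enters only after n halvings, at scale (b - a)/2^n. -/
lemma cell_error_le_bisect (hw : IsOscillationModulus T α x w) (hx : Measurable x) {B : ℝ}
    (hB : ∀ s ∈ Icc 0 T, |x s| ≤ B) (hγ : 0 ≤ γ) (hγ' : γ ≤ 1)
    (hd : ∀ u, HasDerivAt h (h' u) u) (hc : Continuous h') (hM : ∀ u ∈ Icc 0 T, |h' u| ≤ M)
    (hC : 0 ≤ C) (hh : ∀ s t, |h t - h s| ≤ C * |t - s| ^ γ) (n : ℕ) :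
    ∀ a b ξ : ℝ, 0 ≤ a → b ≤ T → a < b → ξ ∈ Icc a b →
    ENNReal.ofReal |(∫ s in a..b, x s * h' s) - x ξ * (h b - h a)| ≤
      ENNReal.ofReal (4 * C) * cellBound γ w a b (2 * (b - a)) +
      ENNReal.ofReal M * ∫⁻ t in Ioc a b, w t ((b - a) / 2 ^ n) := by
  induction n with
  | zero =>
    intro a b ξ ha hb _ hξ
    rw [pow_zero, div_one]
    exact (cell_error_le_of_lipschitz hw hx hB hd hc hM ha hb hξ).trans le_add_self
  | succ n ih =>
    intro a b ξ ha hb hab hξ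
    set m := (a + b) / 2 with hm
    have ham : a < m := by linarith
    have hmb : m < b := by linarith
    have e1 : m - a = (b - a) / 2 := by rw [hm]; ring
    have e2 : b - m = (b - a) / 2 := by rw [hm]; ring
    have hiT : ∀ c d : ℝ, 0 ≤ c → c ≤ d → d ≤ T →
        IntervalIntegrable (fun s => x s * h' s) volume c d := by
      intro c d hc0 hcd hdT
      have hi : IntervalIntegrable x volume c d := by
        rw [intervalIntegrable_iff_integrableOn_Ioc_of_le hcd]
        refine Integrable.of_bound hx.aestronglyMeasurable B ?_
        filter_upwards [ae_restrict_mem measurableSet_Ioc] with s hs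
        exact hB s ⟨hc0.trans hs.1.le, hs.2.trans hdT⟩
      exact hi.mul_continuousOn hc.continuousOn
    -- The midpoint tags both halves, so the two one-point terms recombine to x m (h b - h a) and
    -- only the change of tag from ξ to m is left.
    have split : (∫ s in a..b, x s * h' s) - x ξ * (h b - h a) =
        (((∫ s in a..m, x s * h' s) - x m * (h m - h a)) +
        ((∫ s in m..b, x s * h' s) - x m * (h b - h m))) + (x m - x ξ) * (h b - h a) := by
      rw [← intervalIntegral.integral_add_adjacent_intervals (hiT a m ha ham.le (hmb.le.trans hb))
        (hiT m b (ha.trans ham.le) hmb.le hb)]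
      ring
    have I1 := ih a m m ha (hmb.le.trans hb) ham ⟨ham.le, le_rfl⟩
    have I2 := ih m b m (ha.trans ham.le) hb hmb ⟨le_rfl, hmb.le⟩
    rw [e1, mul_div_cancel₀ _ (two_ne_zero)] at I1
    rw [e2, mul_div_cancel₀ _ (two_ne_zero)] at I2
    have hba : 0 < b - a := sub_pos.2 hab
    -- Write (b - a)^γ as (b - a) times (b - a)^{γ-1}. The first factor is the length of the cell,
    -- so the bound becomes an integral over t in the cell, and `modulus_le_lintegral` applies at
    -- each t.
    have I3 : ENNReal.ofReal |(x m - x ξ) * (h b - h a)| ≤ ENNReal.ofReal (4 * C) *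
        ∫⁻ t in Ioc a b, ∫⁻ r in Ioc (b - a) (2 * (b - a)),
          w t r * ENNReal.ofReal (r ^ (γ - 2)) := by
      have hq : |(x m - x ξ) * (h b - h a)| ≤
          |x m - x ξ| * (b - a) ^ (γ - 1) * C * (b - a) := by
        rw [abs_mul]
        have h5 := hh a b
        rw [abs_of_pos hba] at h5
        calc |x m - x ξ| * |h b - h a| ≤ |x m - x ξ| * (C * (b - a) ^ γ) := by gcongr
          _ = |x m - x ξ| * (b - a) ^ (γ - 1) * C * (b - a) := by
            rw [show γ = γ - 1 + 1 by ring, Real.rpow_add hba, Real.rpow_one]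
            ring_nf
      calc ENNReal.ofReal |(x m - x ξ) * (h b - h a)|
          ≤ ENNReal.ofReal (|x m - x ξ| * (b - a) ^ (γ - 1) * C * (b - a)) :=
            ENNReal.ofReal_le_ofReal hq
        _ = ∫⁻ _ in Ioc a b, ENNReal.ofReal C *
              (ENNReal.ofReal |x m - x ξ| * ENNReal.ofReal ((b - a) ^ (γ - 1))) := by
            rw [setLIntegral_const, Real.volume_Ioc, ENNReal.ofReal_mul (by positivity),
              ENNReal.ofReal_mul (by positivity), ENNReal.ofReal_mul (by positivity)]
            ring
        _ ≤ ∫⁻ t in Ioc a b, ENNReal.ofReal (4 * C) * ∫⁻ r in Ioc (b - a) (2 * (b - a)),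
              w t r * ENNReal.ofReal (r ^ (γ - 2)) := by
            refine setLIntegral_mono' measurableSet_Ioc fun t ht => ?_
            have ht' : t ∈ Icc 0 T := ⟨ha.trans ht.1.le, ht.2.trans hb⟩
            rw [mul_comm 4 C, ENNReal.ofReal_mul hC, ENNReal.ofReal_ofNat, mul_assoc]
            refine mul_le_mul' le_rfl ((mul_le_mul' ?_ le_rfl).trans
              (modulus_le_lintegral hw hγ hγ' hba t))
            refine hw.le t ht' m ⟨ha.trans ham.le, hmb.le.trans hb⟩ ξ
              ⟨ha.trans hξ.1, hξ.2.trans hb⟩ _ ?_ ?_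
            · rw [abs_le]
              constructor <;> linarith [ht.1, ht.2]
            · rw [abs_le]
              constructor <;> linarith [ht.1, ht.2, hξ.1, hξ.2]
        _ = _ := lintegral_const_mul' _ _ ENNReal.ofReal_ne_top
    rw [split]
    refine (ofReal_abs_add_le _ _).trans ?_
    refine (add_le_add ((ofReal_abs_add_le _ _).trans (add_le_add I1 I2)) I3).trans ?_
    rw [← cellBound_bisect hw ham.le hmb.le hba.le, pow_succ', ← div_div,
      lintegral_Ioc_add_adjacent (fun t => w t ((b - a) / 2 / 2 ^ n)) ham.le hmb.le]
    refine le_of_eq ?_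
    ring

/-- The weight r^{γ-2} is the one for the moment of order q = 1-γ; this is where α + γ > 1 enters.
-/
lemma cellBound_lt_top (hw : IsOscillationModulus T α x w) (hαγ : 1 < α + γ) :
    cellBound γ w 0 T (2 * T) < ∞ := by
  have h := hw.lintegral_lt_top (1 - γ) (by linarith)
  unfold cellBound
  rw [show γ - 2 = -(1 - γ + 1) by ring]
  exact h

lemma tendsto_cellBound (hw : IsOscillationModulus T α x w) (hαγ : 1 < α + γ) {ℓ : ℕ → ℝ}
    (hℓ : Filter.Tendsto ℓ Filter.atTop (nhds 0)) (hℓT : ∀ n, ℓ n ≤ 2 * T) :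
    Filter.Tendsto (fun n => cellBound γ w 0 T (ℓ n)) Filter.atTop (nhds 0) := by
  have h := cellBound_lt_top hw hαγ
  set f : ℝ → ℝ → ℝ≥0∞ := fun t r => w t r * ENNReal.ofReal (r ^ (γ - 2)) with hf
  have hfin : ∀ᵐ t ∂(volume.restrict (Ioc 0 T)), ∫⁻ r in Ioc 0 (2 * T), f t r < ∞ :=
    ae_lt_top (measurable_lintegral_modulus hw _) h.ne
  have hz : ∫⁻ _ in Ioc 0 T, (0 : ℝ≥0∞) = 0 := lintegral_zero
  rw [← hz]
  refine tendsto_lintegral_of_dominated_convergence (fun t => ∫⁻ r in Ioc 0 (2 * T), f t r)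
    (fun n => measurable_lintegral_modulus hw _) (fun n => ?_) h.ne ?_
  · exact Filter.Eventually.of_forall fun t => lintegral_mono_set (Ioc_subset_Ioc_right (hℓT n))
  · filter_upwards [hfin] with t ht
    have hvol : Filter.Tendsto (fun n => (volume.restrict (Ioc 0 (2 * T))) (Ioc 0 (ℓ n)))
        Filter.atTop (nhds 0) := by
      have h2 : Filter.Tendsto (fun n => ENNReal.ofReal (ℓ n)) Filter.atTop (nhds 0) := by
        simpa using ENNReal.tendsto_ofReal hℓ
      refine tendsto_of_tendsto_of_tendsto_of_le_of_le tendsto_const_nhds h2 (fun _ => zero_le) ?_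
      intro n
      refine (Measure.restrict_apply_le _ _).trans ?_
      rw [Real.volume_Ioc, sub_zero]
    have h3 := tendsto_setLIntegral_zero ht.ne hvol
    refine h3.congr fun n => ?_
    rw [Measure.restrict_restrict measurableSet_Ioc, inter_eq_left.2 (Ioc_subset_Ioc_right (hℓT n))]

/-- Letting the number of bisections tend to infinity removes the term with M; the resulting
constant depends on h only through C. -/
lemma cell_error_le (hw : IsOscillationModulus T α x w) (hx : Measurable x) {B : ℝ}
    (hB : ∀ s ∈ Icc 0 T, |x s| ≤ B) (hγ : 0 ≤ γ) (hγ' : γ ≤ 1) (hαγ : 1 < α + γ)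
    (hd : ∀ u, HasDerivAt h (h' u) u) (hc : Continuous h')
    (hC : 0 ≤ C) (hh : ∀ s t, |h t - h s| ≤ C * |t - s| ^ γ) {a b ξ : ℝ} (ha : 0 ≤ a) (hb : b ≤ T)
    (hξ : ξ ∈ Icc a b) :
    ENNReal.ofReal |(∫ s in a..b, x s * h' s) - x ξ * (h b - h a)| ≤
      ENNReal.ofReal (4 * C) * cellBound γ w a b (2 * (b - a)) := by
  rcases (hξ.1.trans hξ.2).eq_or_lt with rfl | hab
  · simp
  obtain ⟨M, hM0, hM, -⟩ := exists_abs_sub_le_of_hasDerivAt hd hc 0 T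
  have hba : 0 < b - a := sub_pos.2 hab
  have hT : 0 < T := by linarith
  have hhalf : Filter.Tendsto (fun n : ℕ => (b - a) / 2 ^ n) Filter.atTop (nhds 0) := by
    have h2 := (tendsto_pow_atTop_nhds_zero_of_lt_one (r := (1 / 2 : ℝ)) (by norm_num)
      (by norm_num)).const_mul (b - a)
    rw [mul_zero] at h2
    refine h2.congr fun n => ?_
    rw [one_div, inv_pow, div_eq_mul_inv]
  have hlim : Filter.Tendsto (fun n : ℕ => ENNReal.ofReal (4 * C) * cellBound γ w a b (2 * (b - a)) +
      ENNReal.ofReal M * ∫⁻ t in Ioc a b, w t ((b - a) / 2 ^ n)) Filter.atTop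
      (nhds (ENNReal.ofReal (4 * C) * cellBound γ w a b (2 * (b - a)) + ENNReal.ofReal M * 0)) := by
    apply Filter.Tendsto.const_add
    apply ENNReal.Tendsto.const_mul _ (Or.inr ENNReal.ofReal_ne_top)
    -- By `modulus_le_lintegral`, w(t,ℓ) is at most 4 ℓ^{1-γ} times its moment over (ℓ, 2ℓ], so the
    -- remainder is controlled by `cellBound` at radius 2ℓ, which tends to 0.
    have hcell := tendsto_cellBound hw hαγ (ℓ := fun n => 2 * ((b - a) / 2 ^ n))
      (by simpa using hhalf.const_mul 2) (fun n => by
        have : (b - a) / 2 ^ n ≤ b - a := div_le_self hba.le (one_le_pow₀ (by norm_num))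
        linarith)
    have hcell2 := ENNReal.Tendsto.const_mul (a := ENNReal.ofReal ((b - a) ^ (1 - γ)) * 4) hcell
      (Or.inr (ENNReal.mul_ne_top ENNReal.ofReal_ne_top (by norm_num)))
    rw [mul_zero] at hcell2
    refine tendsto_of_tendsto_of_tendsto_of_le_of_le tendsto_const_nhds hcell2
      (fun _ => zero_le) fun n => ?_
    simp only
    have hℓ : 0 < (b - a) / 2 ^ n := by positivity
    set ℓ := (b - a) / 2 ^ n with hℓdef
    have hℓle : ℓ ≤ b - a := div_le_self hba.le (one_le_pow₀ (by norm_num))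
    unfold cellBound
    rw [mul_assoc, ← lintegral_const_mul' _ _ (by norm_num),
      ← lintegral_const_mul' _ _ ENNReal.ofReal_ne_top]
    refine (lintegral_mono_set (Ioc_subset_Ioc ha hb)).trans (lintegral_mono fun t => ?_)
    have h1 := modulus_le_lintegral (γ := γ) hw hγ hγ' hℓ t
    calc w t ℓ = ENNReal.ofReal (ℓ ^ (1 - γ)) * (w t ℓ * ENNReal.ofReal (ℓ ^ (γ - 1))) := by
          rw [mul_comm, mul_assoc, ← ENNReal.ofReal_mul (by positivity), ← Real.rpow_add hℓ,
            show γ - 1 + (1 - γ) = 0 by ring, Real.rpow_zero, ENNReal.ofReal_one, mul_one]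
      _ ≤ _ := by
        refine mul_le_mul' (ENNReal.ofReal_le_ofReal
          (Real.rpow_le_rpow hℓ.le hℓle (by linarith))) (h1.trans ?_)
        refine mul_le_mul' le_rfl (lintegral_mono_set (Ioc_subset_Ioc_left hℓ.le))
  rw [mul_zero, add_zero] at hlim
  exact ge_of_tendsto' hlim fun n =>
    cell_error_le_bisect hw hx hB hγ hγ' hd hc hM hC hh n a b ξ ha hb hab hξ

/-- Tagged partitions of `[0,T]` whose cells may degenerate to points. -/
def IsWeakTaggedPartition (T : ℝ) (k : ℕ) (t ξ : ℕ → ℝ) : Prop :=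
  t 0 = 0 ∧ t k = T ∧ (∀ i < k, t i ≤ t (i + 1)) ∧ ∀ i < k, ξ i ∈ Icc (t i) (t (i + 1))

lemma IsTaggedPartition.isWeakTaggedPartition {k : ℕ} {t ξ : ℕ → ℝ} (h : IsTaggedPartition T k t ξ) :
    IsWeakTaggedPartition T k t ξ :=
  ⟨h.1, h.2.1, fun i hi => (h.2.2.1 i hi).le, h.2.2.2⟩

lemma IsWeakTaggedPartition.mono {k : ℕ} {t ξ : ℕ → ℝ} (h : IsWeakTaggedPartition T k t ξ)
    {i j : ℕ} (hij : i ≤ j) (hj : j ≤ k) : t i ≤ t j := by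
  induction j, hij using Nat.le_induction with
  | base => exact le_rfl
  | succ j _ ih => exact (ih (by lia)).trans (h.2.2.1 j (by lia))

lemma IsWeakTaggedPartition.mem_Icc {k : ℕ} {t ξ : ℕ → ℝ} (h : IsWeakTaggedPartition T k t ξ)
    {i : ℕ} (hi : i ≤ k) : t i ∈ Icc 0 T := by
  have h1 := h.mono (Nat.zero_le i) hi
  have h2 := h.mono hi le_rfl
  rw [h.1] at h1
  rw [h.2.1] at h2
  exact ⟨h1, h2⟩

/-- Cell bounds are integrals over disjoint ranges of t, so they add up to an integral over [0,T],
with radius at most twice the mesh. Degenerate cells are allowed because summation by parts produces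
them. -/
lemma rsSum_error_le (hw : IsOscillationModulus T α x w) (hx : Measurable x) {B : ℝ}
    (hB : ∀ s ∈ Icc 0 T, |x s| ≤ B) (hγ : 0 ≤ γ) (hγ' : γ ≤ 1) (hαγ : 1 < α + γ)
    (hd : ∀ u, HasDerivAt h (h' u) u) (hc : Continuous h')
    (hC : 0 ≤ C) (hh : ∀ s t, |h t - h s| ≤ C * |t - s| ^ γ) {k : ℕ} {t ξ : ℕ → ℝ} {δ : ℝ}
    (hp : IsWeakTaggedPartition T k t ξ) (hmesh : ∀ i < k, t (i + 1) - t i < δ) :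
    ENNReal.ofReal |rsSum x h k t ξ - ∫ s in (0 : ℝ)..T, x s * h' s| ≤
      ENNReal.ofReal (4 * C) * cellBound γ w 0 T (2 * δ) := by
  have hiT : ∀ c d : ℝ, 0 ≤ c → c ≤ d → d ≤ T →
      IntervalIntegrable (fun s => x s * h' s) volume c d := by
    intro c d hc0 hcd hdT
    have hi : IntervalIntegrable x volume c d := by
      rw [intervalIntegrable_iff_integrableOn_Ioc_of_le hcd]
      refine Integrable.of_bound hx.aestronglyMeasurable B ?_
      filter_upwards [ae_restrict_mem measurableSet_Ioc] with s hs
      exact hB s ⟨hc0.trans hs.1.le, hs.2.trans hdT⟩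
    exact hi.mul_continuousOn hc.continuousOn
  have key : ∀ j ≤ k, ENNReal.ofReal |(∫ s in (0 : ℝ)..(t j), x s * h' s) - rsSum x h j t ξ| ≤
      ENNReal.ofReal (4 * C) * cellBound γ w 0 (t j) (2 * δ) := by
    intro j
    induction j with
    | zero =>
      intro _
      simp [rsSum, hp.1]
    | succ j ih =>
      intro hj
      have hm0 := hp.mem_Icc (show j ≤ k by lia)
      have hm1 := hp.mem_Icc hj
      have hle := hp.2.2.1 j (by lia)
      have e : (∫ s in (0 : ℝ)..(t (j + 1)), x s * h' s) - rsSum x h (j + 1) t ξ =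
          ((∫ s in (0 : ℝ)..(t j), x s * h' s) - rsSum x h j t ξ) +
          ((∫ s in (t j)..(t (j + 1)), x s * h' s) - x (ξ j) * (h (t (j + 1)) - h (t j))) := by
        rw [← intervalIntegral.integral_add_adjacent_intervals (hiT 0 (t j) le_rfl hm0.1 hm0.2)
          (hiT (t j) (t (j + 1)) hm0.1 hle hm1.2)]
        unfold rsSum
        rw [Finset.sum_range_succ]
        ring
      rw [e]
      refine (ofReal_abs_add_le _ _).trans ((add_le_add (ih (by lia))
        (cell_error_le hw hx hB hγ hγ' hαγ hd hc hC hh hm0.1 hm1.2 (hp.2.2.2 j (by lia)))).trans ?_)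
      rw [← mul_add]
      refine mul_le_mul' le_rfl ?_
      conv_rhs => unfold cellBound
      rw [lintegral_Ioc_add_adjacent _ hm0.1 hle]
      refine add_le_add le_rfl (lintegral_mono fun u => lintegral_mono_set (Ioc_subset_Ioc_right ?_))
      linarith [hmesh j (by lia)]
  have h1 := key k le_rfl
  rw [hp.2.1] at h1
  rwa [abs_sub_comm]

end Cells

/-! ### Smooth approximation of the integrator -/

section Smooth

open scoped Convolution

variable {T α γ C : ℝ} {x y : ℝ → ℝ} {w : ℝ → ℝ → ℝ≥0∞}

lemma continuous_of_holder (hγ : 0 < γ) (hy : ∀ s t, |y t - y s| ≤ C * |t - s| ^ γ) :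
    Continuous y := by
  rw [continuous_iff_continuousAt]
  intro s
  have h1 : ContinuousAt (fun t => C * |t - s| ^ γ) s :=
    continuousAt_const.mul (ContinuousAt.rpow_const (by fun_prop) (Or.inr hγ.le))
  have h2 := h1.tendsto
  simp only [sub_self, abs_zero, Real.zero_rpow hγ.ne', mul_zero] at h2
  rw [ContinuousAt, tendsto_iff_norm_sub_tendsto_zero]
  exact squeeze_zero (fun _ => norm_nonneg _) (fun t => hy s t) h2

/-- Averaging translates against a nonnegative weight of mass one preserves the modulus of
continuity, constant included. -/
lemma abs_normed_convolution_sub_le (φ : ContDiffBump (0 : ℝ)) (hγ : 0 < γ)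
    (hy : ∀ s t, |y t - y s| ≤ C * |t - s| ^ γ) (s t : ℝ) :
    |(φ.normed volume ⋆[ContinuousLinearMap.lsmul ℝ ℝ, volume] y) t -
      (φ.normed volume ⋆[ContinuousLinearMap.lsmul ℝ ℝ, volume] y) s| ≤ C * |t - s| ^ γ := by
  have hc := continuous_of_holder hγ hy
  have hex : ∀ u, Integrable (fun v => φ.normed volume v * y (u - v)) := fun u =>
    HasCompactSupport.convolutionExists_left (ContinuousLinearMap.lsmul ℝ ℝ)
      φ.hasCompactSupport_normed φ.continuous_normed hc.locallyIntegrable u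
  simp only [convolution_def, ContinuousLinearMap.lsmul_apply, smul_eq_mul]
  rw [← integral_sub (hex t) (hex s)]
  have hle := norm_integral_le_of_norm_le
    (f := fun v => φ.normed volume v * y (t - v) - φ.normed volume v * y (s - v))
    (g := fun v => φ.normed volume v * (C * |t - s| ^ γ)) (φ.integrable_normed.mul_const _)
    (Filter.Eventually.of_forall fun v => by
      rw [← mul_sub, norm_mul, Real.norm_of_nonneg (φ.nonneg_normed v)]
      refine mul_le_mul_of_nonneg_left ?_ (φ.nonneg_normed v)
      have := hy (s - v) (t - v)
      rwa [sub_sub_sub_cancel_right] at this)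
  rwa [integral_mul_const, φ.integral_normed, one_mul] at hle

/-- A Hölder function that is constant after `T` is the limit of smooth functions with the same
Hölder constant that are constant after `T`. -/
lemma exists_smooth_approximation (hγ : 0 < γ) (hy : ∀ s t, |y t - y s| ≤ C * |t - s| ^ γ)
    (hyT : ∀ t, T ≤ t → y t = y T) :
    ∃ yn φ φ' : ℕ → ℝ → ℝ, (∀ n u, HasDerivAt (yn n) (φ n u) u) ∧
      (∀ n u, HasDerivAt (φ n) (φ' n u) u) ∧ (∀ n, Continuous (φ' n)) ∧
      (∀ n u, T ≤ u → φ n u = 0) ∧ (∀ n u, T ≤ u → φ' n u = 0) ∧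
      (∀ n s t, |yn n t - yn n s| ≤ C * |t - s| ^ γ) ∧
      ∀ t, Filter.Tendsto (fun n => yn n t) Filter.atTop (nhds (y t)) := by
  have hc := continuous_of_holder hγ hy
  let ρ : ℕ → ℝ := fun n => 1 / ((n : ℝ) + 1)
  have hρ : ∀ n, 0 < ρ n := fun n => Nat.one_div_pos_of_nat
  have hρ0 : Filter.Tendsto ρ Filter.atTop (nhds 0) := tendsto_one_div_add_atTop_nhds_zero_nat
  let b : ℕ → ContDiffBump (0 : ℝ) := fun n => ⟨ρ n / 2, ρ n, half_pos (hρ n), half_lt_self (hρ n)⟩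
  -- The shift by twice the mollification radius makes the smoothed function constant already on (T
  -- - ρ, ∞), so both derivatives vanish at T itself.
  let g : ℕ → ℝ → ℝ := fun n t => y (t + 2 * ρ n)
  have hg : ∀ n s t, |g n t - g n s| ≤ C * |t - s| ^ γ := by
    intro n s t
    have := hy (s + 2 * ρ n) (t + 2 * ρ n)
    rwa [add_sub_add_right_eq_sub] at this
  let yn : ℕ → ℝ → ℝ := fun n =>
    (b n).normed volume ⋆[ContinuousLinearMap.lsmul ℝ ℝ, volume] g n
  have hsm : ∀ n, ContDiff ℝ 2 (yn n) := fun n =>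
    (b n).hasCompactSupport_normed.contDiff_convolution_left _ (b n).contDiff_normed
      (continuous_of_holder hγ (hg n)).locallyIntegrable
  have hsm' : ∀ n, ContDiff ℝ 1 (deriv (yn n)) := fun n =>
    ((contDiff_succ_iff_deriv (n := 1)).1 (hsm n)).2.2
  have hconst : ∀ n u, T - ρ n < u → yn n u = y T := by
    intro n u hu
    have h1 : ∀ v ∈ Metric.ball u (b n).rOut, g n v = g n u := by
      intro v hv
      rw [Metric.mem_ball, Real.dist_eq, abs_lt] at hv
      have h3 : (b n).rOut = ρ n := rfl
      rw [h3] at hv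
      simp only [g]
      rw [hyT (v + 2 * ρ n) (by linarith [hρ n, hv.1]), hyT (u + 2 * ρ n) (by linarith [hρ n])]
    have h2 := (b n).normed_convolution_eq_right (μ := volume) h1
    simp only [yn]
    rw [h2]
    exact hyT _ (by linarith [hρ n])
  have hd0 : ∀ n u, T - ρ n < u → deriv (yn n) u = 0 := by
    intro n u hu
    have : yn n =ᶠ[nhds u] fun _ => y T := by
      filter_upwards [Ioi_mem_nhds hu] with v hv
      exact hconst n v hv
    rw [this.deriv_eq, deriv_const]
  have hd1 : ∀ n u, T - ρ n < u → deriv (deriv (yn n)) u = 0 := by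
    intro n u hu
    have : deriv (yn n) =ᶠ[nhds u] fun _ => (0 : ℝ) := by
      filter_upwards [Ioi_mem_nhds hu] with v hv
      exact hd0 n v hv
    rw [this.deriv_eq, deriv_const]
  refine ⟨yn, fun n => deriv (yn n), fun n => deriv (deriv (yn n)), ?_, ?_, ?_, ?_, ?_, ?_, ?_⟩
  · exact fun n u => ((hsm n).differentiable (by norm_num) u).hasDerivAt
  · exact fun n u => ((hsm' n).differentiable (by norm_num) u).hasDerivAt
  · exact fun n => (hsm' n).continuous_deriv le_rfl
  · exact fun n u hu => hd0 n u (by linarith [hρ n])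
  · exact fun n u hu => hd1 n u (by linarith [hρ n])
  · exact fun n s t => abs_normed_convolution_sub_le (b n) hγ (hg n) s t
  · intro t
    refine ContDiffBump.convolution_tendsto_right (φ := b) (g := g) (k := fun _ => t) hρ0 ?_ ?_
      tendsto_const_nhds
    · exact Filter.Eventually.of_forall fun n =>
        (continuous_of_holder hγ (hg n)).aestronglyMeasurable
    · have h1 : Filter.Tendsto (fun p : ℕ × ℝ => p.2 + 2 * ρ p.1) (Filter.atTop ×ˢ nhds t)
          (nhds (t + 2 * 0)) :=
        Filter.tendsto_snd.add ((hρ0.comp Filter.tendsto_fst).const_mul 2)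
      rw [mul_zero, add_zero] at h1
      exact (hc.tendsto t).comp h1

/-- The Riemann–Stieltjes and the generalized Lebesgue–Stieltjes integral of a path with an
oscillation modulus against a Hölder path exist and agree. -/
theorem exists_hasGLSIntegral_and_rsSum_tendsto (hT : 0 < T) (hα : α ≤ 1) (hγ : 0 < γ)
    (hγ' : γ ≤ 1) (hαγ : 1 < α + γ) (hw : IsOscillationModulus T α x w) (hx : Measurable x) {B : ℝ}
    (hB : ∀ s ∈ Icc 0 T, |x s| ≤ B) (hC : 0 ≤ C) (hy : ∀ s t, |y t - y s| ≤ C * |t - s| ^ γ)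
    (hyT : ∀ t, T ≤ t → y t = y T) :
    ∃ J : ℝ, (∀ β ∈ Ioo (1 - γ) α, HasGLSIntegral T β x y J) ∧
      ∀ ε > 0, ∃ δ > 0, ∀ (k : ℕ) (t ξ : ℕ → ℝ), IsWeakTaggedPartition T k t ξ →
        (∀ i < k, t (i + 1) - t i < δ) → |rsSum x y k t ξ - J| < ε := by
  obtain ⟨yn, φ, φ', h1, h2, h3, h4, h5, h6, h7⟩ := exists_smooth_approximation hγ hy hyT
  have hym : Measurable y := (continuous_of_holder hγ hy).measurable
  have hynm : ∀ n, Measurable (yn n) := fun n => (continuous_of_holder hγ (h6 n)).measurable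
  have hφ : ∀ n, Continuous (φ n) := fun n =>
    continuous_iff_continuousAt.2 fun u => (h2 n u).continuousAt
  -- The approximating integrals ∫ x φ_n do not involve β, so uniqueness of limits gives one value
  -- for all β.
  have hlim : ∀ β ∈ Ioo (1 - γ) α, Filter.Tendsto (fun n => ∫ s in (0 : ℝ)..T, x s * φ n s)
      Filter.atTop (nhds (∫ s in (0 : ℝ)..T, glsIntegrand T β x y s)) := by
    intro β hβ
    have hβ0 : 0 < β := by linarith [hβ.1]
    have hβ1 : β < 1 := by linarith [hβ.2]
    refine (tendsto_integral_glsIntegrand h6 hC hynm hT.le hβ0 hβ1 (by linarith [hβ.1]) h7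
      (intervalIntegrable_weylLeft hβ1 hT.le hx hB hw hβ.2)).congr fun n => ?_
    exact integral_glsIntegrand_of_hasDerivAt hβ0 hβ1 hT.le hx hB
      (integrableOn_increment hx hw hβ.2) (h1 n) (h2 n) (h3 n) (h4 n) (h5 n)
  obtain ⟨β₀, hβ₀⟩ : (Ioo (1 - γ) α).Nonempty := nonempty_Ioo.2 (by linarith)
  refine ⟨∫ s in (0 : ℝ)..T, glsIntegrand T β₀ x y s, fun β hβ => ?_, fun ε hε => ?_⟩
  · have hβ0 : 0 < β := by linarith [hβ.1]
    have hβ1 : β < 1 := by linarith [hβ.2]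
    exact ⟨memBesov₂_of_isOscillationModulus hβ1 hT.le hx hB hw hβ.2,
      memBesov₁_of_holder hy hC hym (by linarith [hβ.1]),
      intervalIntegrable_glsIntegrand hy hC hym hT.le hβ0 hβ1 (by linarith [hβ.1])
        (intervalIntegrable_weylLeft hβ1 hT.le hx hB hw hβ.2),
      tendsto_nhds_unique (hlim β hβ) (hlim β₀ hβ₀)⟩
  · have hρ0 : Filter.Tendsto (fun n : ℕ => 2 * (T * (1 / ((n : ℝ) + 1)))) Filter.atTop
        (nhds 0) := by
      simpa using (tendsto_one_div_add_atTop_nhds_zero_nat.const_mul T).const_mul 2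
    have hcell := ENNReal.Tendsto.const_mul (a := ENNReal.ofReal (4 * C))
      (tendsto_cellBound hw hαγ hρ0 fun n => by
        have : 1 / ((n : ℝ) + 1) ≤ 1 := by
          rw [div_le_one (by positivity)]
          linarith [n.cast_nonneg (α := ℝ)]
        nlinarith) (Or.inr ENNReal.ofReal_ne_top)
    rw [mul_zero] at hcell
    -- The mesh bound is T/(n+1) with n so large that the uniform error at radius 2T/(n+1) is below
    -- ε.
    obtain ⟨n, hn⟩ := (hcell.eventually_lt_const (ENNReal.ofReal_pos.2 hε)).exists
    refine ⟨T * (1 / ((n : ℝ) + 1)), by positivity, fun k t ξ hp hmesh => ?_⟩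
    -- For a fixed partition the sum depends on finitely many values of the integrator, so the
    -- uniform error bound survives pointwise convergence.
    have hsum : Filter.Tendsto (fun m => rsSum x (yn m) k t ξ) Filter.atTop
        (nhds (rsSum x y k t ξ)) :=
      tendsto_finsetSum _ fun i _ => ((h7 _).sub (h7 _)).const_mul _
    have hfin := (ENNReal.tendsto_ofReal (hsum.sub (hlim β₀ hβ₀)).abs)
    have hle := le_of_tendsto' hfin fun m =>
      rsSum_error_le hw hx hB hγ.le hγ' hαγ (h1 m) (hφ m) hC (h6 m) hp hmesh
    exact (ENNReal.ofReal_lt_ofReal_iff hε).1 (hle.trans_lt hn)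

end Smooth

/-! ### Summation by parts -/

/-- The tags of a partition, completed by the endpoints of the interval. -/
noncomputable def tagPoints (T : ℝ) (k : ℕ) (ξ : ℕ → ℝ) : ℕ → ℝ
  | 0 => 0
  | i + 1 => if i < k then ξ i else T

section Parts

variable {T : ℝ} {x y : ℝ → ℝ} {k : ℕ} {t ξ : ℕ → ℝ}

/-- Abel summation: tags of one sum are partition points of the other. The completed tags number k +
2, hence k + 1 cells. -/
lemma rsSum_add_rsSum_tagPoints (h : IsWeakTaggedPartition T k t ξ) :
    rsSum x y (k + 1) (tagPoints T k ξ) t + rsSum y x k t ξ = x T * y T - x 0 * y 0 := by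
  have key : ∀ j ≤ k, rsSum x y j (tagPoints T k ξ) t + rsSum y x j t ξ =
      x (t j) * y (tagPoints T k ξ j) - x 0 * y 0 := by
    intro j
    induction j with
    | zero =>
      intro _
      simp [rsSum, h.1, tagPoints]
    | succ j ih =>
      intro hj
      have ih := ih (by lia)
      have e : tagPoints T k ξ (j + 1) = ξ j := if_pos (by lia)
      unfold rsSum at ih ⊢
      rw [Finset.sum_range_succ, Finset.sum_range_succ, e]
      linear_combination ih
  have hk := key k le_rfl
  have e : tagPoints T k ξ (k + 1) = T := if_neg (lt_irrefl k)
  unfold rsSum at hk ⊢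
  rw [Finset.sum_range_succ, e, h.2.1]
  rw [h.2.1] at hk
  linear_combination hk

lemma tagPoints_le (h : IsWeakTaggedPartition T k t ξ) {i : ℕ} (hi : i ≤ k) :
    tagPoints T k ξ i ≤ t i := by
  cases i with
  | zero => exact h.1.ge
  | succ i =>
    rw [tagPoints, if_pos (by lia)]
    exact (h.2.2.2 i (by lia)).2

lemma le_tagPoints (h : IsWeakTaggedPartition T k t ξ) {i : ℕ} (hi : i ≤ k) :
    t i ≤ tagPoints T k ξ (i + 1) := by
  rw [tagPoints]
  split_ifs with hik
  · exact (h.2.2.2 i hik).1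
  · exact (h.mem_Icc hi).2

/-- Tags and partition points interlace. Consecutive tags may coincide at a common partition point,
which is why degenerate cells must be admitted. -/
lemma isWeakTaggedPartition_tagPoints (h : IsWeakTaggedPartition T k t ξ) :
    IsWeakTaggedPartition T (k + 1) (tagPoints T k ξ) t :=
  ⟨rfl, if_neg (lt_irrefl k), fun _ hi => (tagPoints_le h (by lia)).trans (le_tagPoints h (by lia)),
    fun _ hi => ⟨tagPoints_le h (by lia), le_tagPoints h (by lia)⟩⟩

/-- Consecutive completed tags lie on either side of one partition point, each within one cell of
it; hence the factor 2. -/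
lemma tagPoints_mesh (h : IsWeakTaggedPartition T k t ξ) {δ : ℝ} (hδ : 0 < δ)
    (hmesh : ∀ i < k, t (i + 1) - t i < δ) (i : ℕ) (hi : i < k + 1) :
    tagPoints T k ξ (i + 1) - tagPoints T k ξ i < 2 * δ := by
  have h1 : tagPoints T k ξ (i + 1) - t i < δ := by
    rw [tagPoints]
    split_ifs with hik
    · linarith [(h.2.2.2 i hik).2, hmesh i hik]
    · rw [show i = k by lia, h.2.1, sub_self]
      exact hδ
  have h2 : t i - tagPoints T k ξ i < δ := by
    cases i with
    | zero => simpa [tagPoints, h.1] using hδ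
    | succ i =>
      rw [tagPoints, if_pos (by lia)]
      linarith [(h.2.2.2 i (by lia)).1, hmesh i (by lia)]
  linarith

lemma hasRSIntegral_of_parts {J : ℝ}
    (h : ∀ ε > 0, ∃ δ > 0, ∀ (k : ℕ) (t ξ : ℕ → ℝ), IsWeakTaggedPartition T k t ξ →
        (∀ i < k, t (i + 1) - t i < δ) → |rsSum x y k t ξ - J| < ε) :
    HasRSIntegral T y x (x T * y T - x 0 * y 0 - J) := by
  intro ε hε
  obtain ⟨δ, hδ, H⟩ := h ε hε
  refine ⟨δ / 2, half_pos hδ, fun k t ξ hp hmesh => ?_⟩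
  have hp := hp.isWeakTaggedPartition
  have h1 := H (k + 1) (tagPoints T k ξ) t (isWeakTaggedPartition_tagPoints hp) fun i hi => by
    have := tagPoints_mesh hp (half_pos hδ) hmesh i hi
    rwa [mul_div_cancel₀ _ two_ne_zero] at this
  have e : rsSum y x k t ξ - (x T * y T - x 0 * y 0 - J) =
      -(rsSum x y (k + 1) (tagPoints T k ξ) t - J) := by
    linear_combination rsSum_add_rsSum_tagPoints (x := x) (y := y) hp
  rwa [e, abs_neg]

end Parts

/-! ### Functions of bounded variation of a process with dominated densities -/

/-- After shifting variables the integrals cancel except over windows of length 2c around N and -N,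
where monotonicity bounds V. The bound gains a factor c even where V jumps. -/
lemma lintegral_monotone_increment_le {V : ℝ → ℝ} (hV : Monotone V) {N c : ℝ} (hN : 0 ≤ N)
    (hc : 0 ≤ c) :
    ∫⁻ y in Icc (-N) N, ENNReal.ofReal (V (y + c) - V (y - c)) ≤
      ENNReal.ofReal (2 * c * (V (N + c) - V (-N - c))) := by
  have hi : ∀ a b : ℝ, IntervalIntegrable V volume a b := fun a b => hV.intervalIntegrable
  have hp : Monotone fun y => V (y + c) := fun a b hab => hV (by linarith)
  have hm : Monotone fun y => V (y - c) := fun a b hab => hV (by linarith)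
  have hNN : -N ≤ N := by linarith
  have e : ∫ y in (-N)..N, (V (y + c) - V (y - c)) =
      (∫ y in (N - c)..(N + c), V y) - ∫ y in (-N - c)..(-N + c), V y := by
    rw [intervalIntegral.integral_sub hp.intervalIntegrable hm.intervalIntegrable,
      intervalIntegral.integral_comp_add_right, intervalIntegral.integral_comp_sub_right,
      intervalIntegral.integral_interval_sub_interval_comm (hi _ _) (hi _ _) (hi _ _),
      intervalIntegral.integral_symm (-N - c), intervalIntegral.integral_symm (N - c)]
    ring
  have b1 : ∫ y in (N - c)..(N + c), V y ≤ 2 * c * V (N + c) := by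
    have := intervalIntegral.integral_mono_on (show N - c ≤ N + c by linarith) (hi _ _)
      (intervalIntegrable_const (c := V (N + c))) fun y hy => hV hy.2
    rw [intervalIntegral.integral_const, smul_eq_mul] at this
    linarith
  have b2 : 2 * c * V (-N - c) ≤ ∫ y in (-N - c)..(-N + c), V y := by
    have := intervalIntegral.integral_mono_on (show -N - c ≤ -N + c by linarith)
      (intervalIntegrable_const (c := V (-N - c))) (hi _ _) fun y hy => hV hy.1
    rw [intervalIntegral.integral_const, smul_eq_mul] at this
    linarith
  rw [setLIntegral_congr Ioc_ae_eq_Icc.symm, ← ofReal_integral_eq_lintegral_ofReal,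
    ← intervalIntegral.integral_of_le hNN, e]
  · apply ENNReal.ofReal_le_ofReal
    linarith
  · exact (hp.intervalIntegrable.sub hm.intervalIntegrable).1
  · exact Filter.Eventually.of_forall fun y => sub_nonneg.2 (hV (by linarith))

section Density

variable {Ω : Type*} [MeasurableSpace Ω] {P : Measure Ω}

lemma lintegral_comp_le_of_pdf_le {X : Ω → ℝ} (hX : HasPDF X P volume) {K : ℝ≥0∞}
    (hK : ∀ᵐ y ∂(volume : Measure ℝ), pdf X P volume y ≤ K) {f : ℝ → ℝ≥0∞} (hf : Measurable f) :
    ∫⁻ ω, f (X ω) ∂P ≤ K * ∫⁻ y, f y := by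
  rw [← lintegral_map' hf.aemeasurable hX.aemeasurable, map_eq_withDensity_pdf X P volume,
    lintegral_withDensity_eq_lintegral_mul _ (measurable_pdf X P volume) hf,
    ← lintegral_const_mul _ hf]
  refine lintegral_mono_ae ?_
  filter_upwards [hK] with y hy
  exact mul_le_mul' hy le_rfl

/-- The local oscillation bound `V (z + N r^α) - V (z - N r^α)`, restricted to `|z| ≤ N`, with the
weight `r^{-(q+1)}`. -/
noncomputable def weightedIncrement (V : ℝ → ℝ) (α q N : ℝ) (z r : ℝ) : ℝ≥0∞ :=
  (Icc (-N) N).indicator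
    (fun z => ENNReal.ofReal (V (z + N * r ^ α) - V (z - N * r ^ α))) z *
    ENNReal.ofReal (r ^ (-(q + 1)))

lemma measurable_weightedIncrement {V : ℝ → ℝ} (hV : Monotone V) (α q N : ℝ) :
    Measurable (Function.uncurry (weightedIncrement V α q N)) := by
  have hVm := hV.measurable
  have h1 : Measurable fun p : ℝ × ℝ =>
      ENNReal.ofReal (V (p.1 + N * p.2 ^ α) - V (p.1 - N * p.2 ^ α)) := by fun_prop
  have h2 := h1.indicator (measurable_fst (measurableSet_Icc (a := -N) (b := N)))
  have h3 : Measurable fun p : ℝ × ℝ => ENNReal.ofReal (p.2 ^ (-(q + 1))) := by fun_prop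
  exact h2.mul h3

/-- Under a law dominated by K times Lebesgue measure, `lintegral_monotone_increment_le` with c = N
r^α turns the increment into a factor r^α; the values of V at radius R keep the constant free of r.
-/
lemma lintegral_weightedIncrement_le {V : ℝ → ℝ} (hV : Monotone V) {α q N R : ℝ} (hα : 0 ≤ α)
    (hN : 0 ≤ N) {r : ℝ} (hr : r ∈ Ioc 0 R) {X : Ω → ℝ} (hX : HasPDF X P volume) {K : ℝ≥0∞}
    (hK : ∀ᵐ y ∂(volume : Measure ℝ), pdf X P volume y ≤ K) :
    ∫⁻ ω, weightedIncrement V α q N (X ω) r ∂P ≤ K *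
      ENNReal.ofReal (2 * N * (V (N + N * R ^ α) - V (-N - N * R ^ α)) * r ^ (α - q - 1)) := by
  have hm : Measurable fun z => weightedIncrement V α q N z r :=
    (measurable_weightedIncrement hV α q N).of_uncurry_right
  refine (lintegral_comp_le_of_pdf_le hX hK hm).trans (mul_le_mul' le_rfl ?_)
  unfold weightedIncrement
  have hc : 0 ≤ N * r ^ α := mul_nonneg hN (Real.rpow_nonneg hr.1.le _)
  have hcR : N * r ^ α ≤ N * R ^ α :=
    mul_le_mul_of_nonneg_left (Real.rpow_le_rpow hr.1.le hr.2 hα) hN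
  rw [lintegral_mul_const' _ _ ENNReal.ofReal_ne_top, lintegral_indicator measurableSet_Icc]
  refine (mul_le_mul' (lintegral_monotone_increment_le hV hN hc) le_rfl).trans ?_
  have h1 : V (-N - N * R ^ α) ≤ V (-N - N * r ^ α) := hV (by linarith)
  have h2 : V (N + N * r ^ α) ≤ V (N + N * R ^ α) := hV (by linarith)
  have h3 : V (-N - N * r ^ α) ≤ V (N + N * r ^ α) := hV (by linarith)
  rw [← ENNReal.ofReal_mul (mul_nonneg (by linarith) (by linarith))]
  apply ENNReal.ofReal_le_ofReal
  rw [show α - q - 1 = α + -(q + 1) by ring, Real.rpow_add hr.1]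
  have h4 := Real.rpow_nonneg hr.1.le α
  have h5 := Real.rpow_nonneg hr.1.le (-(q + 1))
  calc 2 * (N * r ^ α) * (V (N + N * r ^ α) - V (-N - N * r ^ α)) * r ^ (-(q + 1))
      ≤ 2 * (N * r ^ α) * (V (N + N * R ^ α) - V (-N - N * R ^ α)) * r ^ (-(q + 1)) := by
        gcongr
    _ = _ := by ring

/-- By Tonelli the expectation is at most the integral of G times that of D r^{α-q-1}, finite
because q < α. A nonnegative variable with finite expectation is almost surely finite. -/
lemma ae_lintegral_weightedIncrement_lt_top [SFinite P] {V : ℝ → ℝ} (hV : Monotone V)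
    {T α q N : ℝ} (hT : 0 ≤ T) (hα : 0 ≤ α) (hq : q < α) (hN : 0 ≤ N) {H : ℝ → Ω → ℝ}
    (hH : Measurable (Function.uncurry H)) (hd : HasDominatedDensities P T H) :
    ∀ᵐ ω ∂P, ∫⁻ t in Ioc 0 T, ∫⁻ r in Ioc 0 (2 * T), weightedIncrement V α q N (H t ω) r < ∞ := by
  obtain ⟨G, hG, hpdf⟩ := hd
  have hwm := measurable_weightedIncrement hV α q N
  have hF : Measurable fun p : (Ω × ℝ) × ℝ => weightedIncrement V α q N (H p.1.2 p.1.1) p.2 := by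
    have h1 : Measurable fun p : (Ω × ℝ) × ℝ => H p.1.2 p.1.1 :=
      hH.comp ((measurable_snd.comp measurable_fst).prodMk (measurable_fst.comp measurable_fst))
    have h2 := hwm.comp (h1.prodMk measurable_snd)
    simp only [Function.comp_def, Function.uncurry] at h2
    exact h2
  have hF2 : Measurable fun p : Ω × ℝ =>
      ∫⁻ r in Ioc 0 (2 * T), weightedIncrement V α q N (H p.2 p.1) r := hF.lintegral_prod_right'
  refine ae_lt_top hF2.lintegral_prod_right' (ne_of_lt ?_)
  rw [lintegral_lintegral_swap hF2.aemeasurable]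
  set D := 2 * N * (V (N + N * (2 * T) ^ α) - V (-N - N * (2 * T) ^ α)) with hD
  have hDint : ∫⁻ r in Ioc 0 (2 * T), ENNReal.ofReal (D * r ^ (α - q - 1)) < ∞ := by
    have hi := (intervalIntegral.intervalIntegrable_rpow' (a := 0) (b := 2 * T)
      (show -1 < α - q - 1 by linarith)).const_mul D
    rw [intervalIntegrable_iff_integrableOn_Ioc_of_le (by linarith)] at hi
    exact lt_of_le_of_lt (lintegral_mono fun r => Real.ofReal_le_enorm _) hi.2
  have hGint : ∫⁻ t in Ioc 0 T, ENNReal.ofReal (G t) < ∞ :=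
    lt_of_le_of_lt (lintegral_mono fun t => Real.ofReal_le_enorm _)
      (hG.mono_set Ioc_subset_Icc_self).2
  calc ∫⁻ t in Ioc 0 T, ∫⁻ ω, (∫⁻ r in Ioc 0 (2 * T), weightedIncrement V α q N (H t ω) r) ∂P
      ≤ ∫⁻ t in Ioc 0 T, ENNReal.ofReal (G t) *
          ∫⁻ r in Ioc 0 (2 * T), ENNReal.ofReal (D * r ^ (α - q - 1)) := by
        refine lintegral_mono_ae ?_
        filter_upwards [ae_restrict_of_ae_restrict_of_subset Ioc_subset_Icc_self hpdf] with t ht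
        have hFt : Measurable fun p : Ω × ℝ => weightedIncrement V α q N (H t p.1) p.2 := by
          have h1 : Measurable fun p : Ω × ℝ => H t p.1 :=
            hH.comp (measurable_const.prodMk measurable_fst)
          have h2 := hwm.comp (h1.prodMk measurable_snd)
          simp only [Function.comp_def, Function.uncurry] at h2
          exact h2
        rw [lintegral_lintegral_swap hFt.aemeasurable,
          ← lintegral_const_mul' _ _ ENNReal.ofReal_ne_top]
        exact setLIntegral_mono' measurableSet_Ioc fun r hr =>
          lintegral_weightedIncrement_le hV hα hN hr ht.1 ht.2
    _ = (∫⁻ t in Ioc 0 T, ENNReal.ofReal (G t)) *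
          ∫⁻ r in Ioc 0 (2 * T), ENNReal.ofReal (D * r ^ (α - q - 1)) :=
        lintegral_mul_const' _ _ hDint.ne
    _ < ∞ := ENNReal.mul_lt_top hGint hDint

/-- A Hölder process has a jointly measurable modification with continuous paths, that is
almost surely equal to it on `[0,T]`. -/
lemma IsHolderProcess.exists_measurable_modification {T : ℝ} (hT : 0 ≤ T) {α : ℝ≥0} (hα : 0 < α)
    {H : ℝ → Ω → ℝ} (hH : IsHolderProcess P T α H) :
    ∃ H' : ℝ → Ω → ℝ, Measurable (Function.uncurry H') ∧ (∀ ω, Continuous fun t => H' t ω) ∧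
      ∀ᵐ ω ∂P, (∀ t ∈ Icc 0 T, H t ω = H' t ω) ∧ (∀ t, H' t ω = H' (projIcc 0 T hT t) ω) ∧
        ∃ C : ℝ≥0, ∀ s t, |H' t ω - H' s ω| ≤ C * |t - s| ^ (α : ℝ) := by
  obtain ⟨s, hsub, hsm, hs0⟩ := exists_measurable_superset_of_null (mem_ae_iff.1 hH.2)
  have hs : ∀ ω, ω ∉ s → ∃ C : ℝ≥0, HolderOnWith C α (fun t => H t ω) (Icc 0 T) := by
    intro ω hω
    by_contra hcon
    exact hω (hsub hcon)
  -- Paths are frozen outside [0,T] by projection, which keeps the Hölder constant, and set to 0 on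
  -- a measurable null set containing the bad ω.
  let H' : ℝ → Ω → ℝ := fun t => sᶜ.indicator (H (projIcc 0 T hT t))
  have hmem : ∀ t : ℝ, (projIcc 0 T hT t : ℝ) ∈ Icc 0 T := fun t => (projIcc 0 T hT t).2
  have hval : ∀ ω, ω ∉ s → ∀ t, H' t ω = H (projIcc 0 T hT t) ω := fun ω hω t =>
    indicator_of_mem (mem_compl hω) _
  have hcont : ∀ ω, Continuous fun t => H' t ω := by
    intro ω
    by_cases hω : ω ∈ s
    · have : (fun t => H' t ω) = fun _ => 0 := by
        ext t
        exact indicator_of_notMem (notMem_compl_iff.2 hω) _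
      rw [this]
      exact continuous_const
    · have : (fun t => H' t ω) = fun t => H (projIcc 0 T hT t) ω := by
        ext t
        exact hval ω hω t
      rw [this]
      obtain ⟨C, hC⟩ := hs ω hω
      exact (hC.continuousOn hα).comp_continuous
        (continuous_subtype_val.comp continuous_projIcc) hmem
  refine ⟨H', measurable_uncurry_of_continuous_of_measurable hcont fun t =>
    (hH.1 _ (hmem t)).indicator hsm.compl, hcont, ?_⟩
  filter_upwards [measure_eq_zero_iff_ae_notMem.1 hs0] with ω hω
  refine ⟨fun t ht => ?_, fun t => ?_, ?_⟩
  · rw [hval ω hω, projIcc_of_mem hT ht]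
  · rw [hval ω hω, hval ω hω, projIcc_val]
  · obtain ⟨C, hC⟩ := hs ω hω
    refine ⟨C, fun a b => ?_⟩
    rw [hval ω hω, hval ω hω]
    have h1 := hC.dist_le (hmem b) (hmem a)
    rw [Real.dist_eq, Real.dist_eq] at h1
    refine h1.trans ?_
    have h2 : |(projIcc 0 T hT b : ℝ) - projIcc 0 T hT a| ≤ |b - a| := abs_projIcc_sub_projIcc hT
    gcongr

lemma HasDominatedDensities.congr {T : ℝ} {H H' : ℝ → Ω → ℝ} (hH : HasDominatedDensities P T H)
    (h : ∀ t ∈ Icc 0 T, H t =ᵐ[P] H' t) : HasDominatedDensities P T H' := by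
  obtain ⟨G, hG, hpdf⟩ := hH
  refine ⟨G, hG, ?_⟩
  filter_upwards [hpdf, ae_restrict_mem measurableSet_Icc] with t ht htT
  refine ⟨(HasPDF.congr_iff (h t htT)).1 ht.1, ?_⟩
  rw [← pdf.congr (h t htT)]
  exact ht.2

end Density

/-! ### Dependence of the integrals on the paths on `[0,T]` only -/

section Congr

variable {T β I : ℝ} {f f' g g' : ℝ → ℝ}

lemma IsTaggedPartition.points_mem_Icc {k : ℕ} {t ξ : ℕ → ℝ} (h : IsTaggedPartition T k t ξ) :
    (∀ i ≤ k, t i ∈ Icc 0 T) ∧ ∀ i < k, ξ i ∈ Icc 0 T := by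
  have hm := fun i (hi : i ≤ k) => h.isWeakTaggedPartition.mem_Icc hi
  exact ⟨hm, fun i hi => ⟨(hm i hi.le).1.trans (h.2.2.2 i hi).1,
    (h.2.2.2 i hi).2.trans (hm (i + 1) hi).2⟩⟩

lemma HasRSIntegral.congr (h : HasRSIntegral T f g I) (hf : EqOn f f' (Icc 0 T))
    (hg : EqOn g g' (Icc 0 T)) : HasRSIntegral T f' g' I := by
  intro ε hε
  obtain ⟨δ, hδ, H⟩ := h ε hε
  refine ⟨δ, hδ, fun k t ξ hp hmesh => ?_⟩
  have e : rsSum f' g' k t ξ = rsSum f g k t ξ := by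
    refine Finset.sum_congr rfl fun i hi => ?_
    rw [Finset.mem_range] at hi
    rw [hf (hp.points_mem_Icc.2 i hi), hg (hp.points_mem_Icc.1 i hi.le),
      hg (hp.points_mem_Icc.1 (i + 1) hi)]
  rw [e]
  exact H k t ξ hp hmesh

lemma measurable_Icc_congr (h : Measurable fun t : Icc 0 T => f t) (hf : EqOn f f' (Icc 0 T)) :
    Measurable fun t : Icc 0 T => f' t := by
  have : (fun t : Icc 0 T => f' t) = fun t : Icc 0 T => f t := funext fun t => (hf t.2).symm
  rwa [this]

lemma MemBesov₂.congr (h : MemBesov₂ T β f) (hf : EqOn f f' (Icc 0 T)) : MemBesov₂ T β f' := by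
  refine ⟨measurable_Icc_congr h.1 hf, lt_of_eq_of_lt ?_ h.2⟩
  unfold besovNorm₂
  congr 1
  · exact setLIntegral_congr_fun measurableSet_Ioc fun s hs => by
      simp only [hf (Ioc_subset_Icc_self hs)]
  · refine setLIntegral_congr_fun measurableSet_Ioc fun s hs => ?_
    refine setLIntegral_congr_fun measurableSet_Ioo fun u hu => ?_
    simp only [hf (Ioc_subset_Icc_self hs), hf (show u ∈ Icc 0 T from ⟨hu.1.le, hu.2.le.trans hs.2⟩)]

lemma MemBesov₁.congr (h : MemBesov₁ T β f) (hf : EqOn f f' (Icc 0 T)) : MemBesov₁ T β f' := by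
  refine ⟨measurable_Icc_congr h.1 hf, lt_of_eq_of_lt ?_ h.2⟩
  unfold besovNorm₁
  refine iSup_congr fun s => iSup_congr fun t => iSup_congr fun hst => ?_
  have hs : s ∈ Icc 0 T := ⟨hst.1, hst.2.1.le.trans hst.2.2⟩
  rw [hf hs, hf ⟨hst.1.trans hst.2.1.le, hst.2.2⟩]
  congr 1
  refine setLIntegral_congr_fun measurableSet_Ioc fun u hu => ?_
  simp only [hf (show u ∈ Icc 0 T from ⟨hst.1.trans hu.1.le, hu.2.trans hst.2.2⟩)]

lemma glsIntegrand_congr (hf : EqOn f f' (Icc 0 T)) (hg : EqOn g g' (Icc 0 T)) :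
    EqOn (glsIntegrand T β f g) (glsIntegrand T β f' g') (Icc 0 T) := by
  intro s hs
  have hTm : T ∈ Icc 0 T := ⟨hs.1.trans hs.2, le_rfl⟩
  have e1 : ∫ u in (0 : ℝ)..s, (f' s - f u) / (s - u) ^ (β + 1) =
      ∫ u in (0 : ℝ)..s, (f' s - f' u) / (s - u) ^ (β + 1) := by
    refine intervalIntegral.integral_congr fun u hu => ?_
    rw [uIcc_of_le hs.1] at hu
    simp only [hf (show u ∈ Icc 0 T from ⟨hu.1, hu.2.trans hs.2⟩)]
  have e2 : ∫ u in s..T, (g' s - g' T - (g u - g' T)) / (u - s) ^ (1 - β + 1) =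
      ∫ u in s..T, (g' s - g' T - (g' u - g' T)) / (u - s) ^ (1 - β + 1) := by
    refine intervalIntegral.integral_congr fun u hu => ?_
    rw [uIcc_of_le hs.2] at hu
    simp only [hg (show u ∈ Icc 0 T from ⟨hs.1.trans hu.1, hu.2⟩)]
  unfold glsIntegrand weylLeft weylRight
  beta_reduce
  rw [hf hs, hg hs, hg hTm, e1, e2]

lemma HasGLSIntegral.congr (h : HasGLSIntegral T β f g I) (hT : 0 ≤ T) (hf : EqOn f f' (Icc 0 T))
    (hg : EqOn g g' (Icc 0 T)) : HasGLSIntegral T β f' g' I := by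
  obtain ⟨h1, h2, h3, h4⟩ := h
  have e := glsIntegrand_congr (β := β) hf hg
  refine ⟨h1.congr hf, h2.congr hg, h3.congr fun s hs => ?_, ?_⟩
  · rw [uIoc_of_le hT] at hs
    exact e (Ioc_subset_Icc_self hs)
  · rw [← h4]
    refine intervalIntegral.integral_congr fun s hs => ?_
    rw [uIcc_of_le hT] at hs
    exact (e hs).symm

end Congr

/-! ### Integration by parts -/

/-- Jordan decomposition: if g is a difference of two monotone functions, their sum serves as V, and
g is Borel. -/
lemma exists_monotone_abs_sub_le {g : ℝ → ℝ} (hg : LocallyBoundedVariationOn g univ) :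
    Measurable g ∧ ∃ V : ℝ → ℝ, Monotone V ∧ ∀ a b, a ≤ b → |g b - g a| ≤ V b - V a := by
  obtain ⟨p, q, hp, hq, rfl⟩ := hg.exists_monotoneOn_sub_monotoneOn
  rw [monotoneOn_univ] at hp hq
  refine ⟨hp.measurable.sub hq.measurable, p + q, hp.add hq, fun a b hab => ?_⟩
  have h1 := hp hab
  have h2 := hq hab
  simp only [Pi.sub_apply, Pi.add_apply]
  rw [abs_le]
  constructor <;> linarith

/-- A function of bounded variation of a Hölder path has the increments of the variation function
as oscillation modulus. -/
lemma isOscillationModulus_comp {T α N : ℝ} (hα : 0 ≤ α) {g V H : ℝ → ℝ} (hV : Monotone V)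
    (hgV : ∀ a b, a ≤ b → |g b - g a| ≤ V b - V a) (hHc : Continuous H) (hN : 0 ≤ N)
    (hH : ∀ s t, |H t - H s| ≤ N * |t - s| ^ α) (hHN : ∀ t, |H t| ≤ N)
    (hfin : ∀ q : ℚ, (q : ℝ) < α →
      ∫⁻ t in Ioc 0 T, ∫⁻ r in Ioc 0 (2 * T), weightedIncrement V α q N (H t) r < ∞) :
    IsOscillationModulus T α (g ∘ H) fun t r =>
      ENNReal.ofReal (V (H t + N * r ^ α) - V (H t - N * r ^ α)) where
  measurable := by
    have := hV.measurable
    have := hHc.measurable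
    unfold Function.uncurry
    fun_prop
  le := by
    intro t _ s _ s' _ r hs hs'
    apply ENNReal.ofReal_le_ofReal
    have key : ∀ u, |u - t| ≤ r → H t - N * r ^ α ≤ H u ∧ H u ≤ H t + N * r ^ α := by
      intro u hu
      have h1 := hH t u
      have h2 : N * |u - t| ^ α ≤ N * r ^ α := by gcongr
      rw [abs_le] at h1
      constructor <;> linarith [h1.1, h1.2]
    have k1 := key s hs
    have k2 := key s' hs'
    simp only [Function.comp]
    rcases le_total (H s) (H s') with hle | hle
    · rw [abs_sub_comm]
      exact (hgV _ _ hle).trans (sub_le_sub (hV k2.2) (hV k1.1))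
    · exact (hgV _ _ hle).trans (sub_le_sub (hV k1.2) (hV k2.1))
  mono := by
    intro t r hr r' _ hrr'
    apply ENNReal.ofReal_le_ofReal
    have h2 : N * r ^ α ≤ N * r' ^ α :=
      mul_le_mul_of_nonneg_left (Real.rpow_le_rpow hr hrr' hα) hN
    exact sub_le_sub (hV (by linarith)) (hV (by linarith))
  lintegral_lt_top := by
    intro q hq
    -- Finiteness is available for rational exponents only. For q < q' < α the weights differ by the
    -- factor r^{q'-q}, at most (2T)^{q'-q} on the range of r.
    obtain ⟨q', h1, h2⟩ := exists_rat_btwn hq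
    refine lt_of_le_of_lt ?_ (ENNReal.mul_lt_top (ENNReal.ofReal_lt_top
      (r := (2 * T) ^ ((q' : ℝ) - q))) (hfin q' h2))
    rw [← lintegral_const_mul' _ _ ENNReal.ofReal_ne_top]
    refine setLIntegral_mono' measurableSet_Ioc fun t _ => ?_
    rw [← lintegral_const_mul' _ _ ENNReal.ofReal_ne_top]
    refine setLIntegral_mono' measurableSet_Ioc fun r hr => ?_
    unfold weightedIncrement
    rw [indicator_of_mem (show H t ∈ Icc (-N) N from abs_le.1 (hHN t)), mul_left_comm]
    refine mul_le_mul' le_rfl ?_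
    rw [← ENNReal.ofReal_mul (Real.rpow_nonneg (hr.1.le.trans hr.2) _)]
    apply ENNReal.ofReal_le_ofReal
    rw [show -(q + 1) = ((q' : ℝ) - q) + -(q' + 1) by ring, Real.rpow_add hr.1]
    exact mul_le_mul_of_nonneg_right (Real.rpow_le_rpow hr.1.le hr.2 (by linarith))
      (Real.rpow_nonneg hr.1.le _)

theorem theorem4p3 {Ω : Type*} [MeasurableSpace Ω] (P : Measure Ω) [IsProbabilityMeasure P]
    (T : ℝ) (hT : 0 < T) (α γ : ℝ≥0) (hα : α ≤ 1) (hγ : γ ≤ 1) (hαγ : 1 < α + γ)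
    (X Y : ℝ → Ω → ℝ) (hX : MemBViC P T α X) (hY : IsHolderProcess P T γ Y) :
    ∀ᵐ ω ∂P, ∃ I J : ℝ,
      HasRSIntegral T (fun t => Y t ω) (fun t => X t ω) I ∧
      (∀ β ∈ Ioo (1 - (γ : ℝ)) (α : ℝ),
        HasGLSIntegral T β (fun t => X t ω) (fun t => Y t ω) J) ∧
      HasRSIntegral T (fun t => X t ω) (fun t => Y t ω) J ∧
      J = X T ω * Y T ω - X 0 ω * Y 0 ω - I := by
  have hα' : (α : ℝ) ≤ 1 := by exact_mod_cast hα
  have hγ' : (γ : ℝ) ≤ 1 := by exact_mod_cast hγ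
  have hαγ' : 1 < (α : ℝ) + γ := by exact_mod_cast hαγ
  have hα0 : 0 < (α : ℝ) := by linarith
  have hγ0 : 0 < (γ : ℝ) := by linarith
  have h0T : (0 : ℝ) ∈ Icc 0 T := ⟨le_rfl, hT.le⟩
  have hTT : T ∈ Icc 0 T := ⟨hT.le, le_rfl⟩
  obtain ⟨g, H, hg, hH, hdens, hXg⟩ := hX
  obtain ⟨hgm, V, hV, hgV⟩ := exists_monotone_abs_sub_le hg
  -- The definition gives measurability of H at each time only; Tonelli needs it jointly in (t, ω).
  obtain ⟨H', hHm, hHc, hHae⟩ := hH.exists_measurable_modification hT.le (by exact_mod_cast hα0)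
  obtain ⟨Y', -, -, hYae⟩ := hY.exists_measurable_modification hT.le (by exact_mod_cast hγ0)
  have hdens' : HasDominatedDensities P T H' := hdens.congr fun t ht => by
    filter_upwards [hHae] with ω hω
    exact hω.1 t ht
  -- Only countably many exponents and localization levels occur, so one null set serves for all of
  -- them.
  have hfin : ∀ᵐ ω ∂P, ∀ (q : ℚ) (N : ℕ), (q : ℝ) < α →
      ∫⁻ t in Ioc 0 T, ∫⁻ r in Ioc 0 (2 * T), weightedIncrement V α q N (H' t ω) r < ∞ := by
    rw [ae_all_iff]
    intro q
    rw [ae_all_iff]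
    intro N
    by_cases hq : (q : ℝ) < α
    · filter_upwards [ae_lintegral_weightedIncrement_lt_top hV hT.le hα0.le hq N.cast_nonneg hHm
        hdens'] with ω hω _
      exact hω
    · exact Filter.Eventually.of_forall fun ω h => absurd h hq
  filter_upwards [hXg, hHae, hYae, hfin] with ω hXω hHω hYω hfinω
  obtain ⟨hHeq, hHproj, C₁, hC₁⟩ := hHω
  obtain ⟨hYeq, hYproj, C₂, hC₂⟩ := hYω
  obtain ⟨M, hM⟩ := isCompact_Icc.exists_bound_of_continuousOn
    ((hHc ω).continuousOn (s := Icc 0 T))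
  -- One integer N, depending on ω, bounds both the Hölder constant and the path of H', so the
  -- indicator |z| ≤ N is never active on this path.
  obtain ⟨N, hN⟩ := exists_nat_ge (max (C₁ : ℝ) M)
  have hHN : ∀ t, |H' t ω| ≤ N := by
    intro t
    rw [hHproj]
    exact (hM _ (projIcc 0 T hT.le t).2).trans ((le_max_right _ _).trans hN)
  have hHol : ∀ s t, |H' t ω - H' s ω| ≤ N * |t - s| ^ (α : ℝ) := fun s t =>
    (hC₁ s t).trans (mul_le_mul_of_nonneg_right ((le_max_left _ _).trans hN)
      (Real.rpow_nonneg (abs_nonneg _) _))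
  have hw := isOscillationModulus_comp (T := T) hα0.le hV hgV (hHc ω) N.cast_nonneg hHol hHN
    fun q hq => hfinω q N hq
  have hB : ∀ s ∈ Icc 0 T, |(g ∘ fun t => H' t ω) s| ≤ |g (-N)| + (V N - V (-N)) := by
    intro s _
    have h1 := abs_le.1 (hHN s)
    have h2 := (hgV _ _ h1.1).trans (sub_le_sub_right (hV h1.2) _)
    have h3 := abs_add_le (g (-N)) (g (H' s ω) - g (-N))
    rw [add_sub_cancel] at h3
    exact h3.trans (by linarith)
  have hYT : ∀ t, T ≤ t → Y' t ω = Y' T ω := by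
    intro t ht
    rw [hYproj, projIcc_of_right_le _ ht]
  obtain ⟨J, hJ, hRS⟩ := exists_hasGLSIntegral_and_rsSum_tendsto hT hα' hγ0 hγ' hαγ' hw
    (hgm.comp (hHc ω).measurable) hB C₂.2 hC₂ hYT
  have eX : EqOn (g ∘ fun t => H' t ω) (fun t => X t ω) (Icc 0 T) := fun t ht => by
    simp only [Function.comp]
    rw [hXω t ht, hHeq t ht]
  have eY : EqOn (fun t => Y' t ω) (fun t => Y t ω) (Icc 0 T) := fun t ht => (hYeq t ht).symm
  have hRS' : HasRSIntegral T (g ∘ fun t => H' t ω) (fun t => Y' t ω) J := by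
    intro ε hε
    obtain ⟨δ, hδ, h⟩ := hRS ε hε
    exact ⟨δ, hδ, fun k t ξ hp => h k t ξ hp.isWeakTaggedPartition⟩
  -- The integral against X is obtained from J, so the integration by parts formula is built into
  -- the value of I.
  have hI := (hasRSIntegral_of_parts hRS).congr eY eX
  refine ⟨_, J, hI, fun β hβ => (hJ β hβ).congr hT.le eX eY, hRS'.congr eX eY, ?_⟩
  rw [eX h0T, eX hTT]
  simp only [hYeq 0 h0T, hYeq T hTT]
  ring
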